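/- Let $m,d\ge 2$ and $I=\mathbb Z/m\mathbb Z$. Let $\bar Q$ be the doubled spin cyclic quiver: its vertices are $I\cup\{\infty\}$, and its arrows are $x_s:s\to s+1$, $y_s=x_s^*:s+1\to s$ ($s\in I$), $v_\alpha:\infty\to 0$, $w_\alpha=v_\alpha^*:0\to\infty$ ($1\le\alpha\le d$). Write $a\mapsto a^*$ for the involution exchanging $x_s\leftrightarrow y_s$, $v_\alpha\leftrightarrow w_\alpha$, $t(a),h(a)$ for the tail and head of $a$, and put $\epsilon(x_s)=\epsilon(v_\alpha)=+1$, $\epsilon(y_s)=\epsilon(w_\alpha)=-1$. Paths are written from left to right and $e_s$ denotes the trivial path at the vertex $s$. Let $A_0$ be the path algebra $\mathbb C\bar Q$ with all elements $1+aa^*$ ($a\in\bar Q$) inverted. Order the arrows with a common tail by $x_s<y_{s-1}$ at $s\in I\setminus\{0\}$, $x_0<y_{m-1}<w_1<\dots<w_d$ at $0$, and $v_1<\dots<v_d$ at $\infty$. Put $x=\sum_{s\in I}x_s$, $y=\sum_{s\in I} y_s$. Let $u$ be one of $x$, $y$, $z=x^{-1}+y$, $\sum_{s\in I}e_s+xy$,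 with $\epsilon(x)=+1$, $\epsilon(y)=-1$, $\epsilon(z)=-1$, $\epsilon(\sum_s e_s+xy)=+1$, and let $A$ be the localisation of $A_0$ at $u$. That is: if $u=x$ or $u=z$, adjoin local inverses $x_s^{-1}=e_{s+1}x_s^{-1}e_s$ with $x_sx_s^{-1}=e_s$, $x_s^{-1}x_s=e_{s+1}$, and $x^{-1}=\sum_s x_s^{-1}$ (then $z$ is locally invertible); if $u=y$, adjoin local inverses of the $y_s$ in the same way; if $u=\sum_s e_s+xy$, then $A=A_0$, since $u$ is already locally invertible. For $a\in\bar Q$ let $\partial/\partial a:A\to A\otimes A$ be the linear map with $\frac{\partial (bc)}{\partial a}=b\,\frac{\partial c}{\partial a}+\frac{\partial b}{\partial a}\,c$ (outer bimodule structure), $\frac{\partial e_s}{\partial a}=0$ and $\frac{\partial b}{\partial a}=\delta_{ab}\,e_{t(a)}\otimes e_{h(a)}$ for arrows $b$. Double derivations form an $A$-bimodule by $(b\,\delta\,c)(f)=\delta(f)'c\otimes b\,\delta(f)''$. For double derivations $\delta_1,\delta_2$ set $$\{\!\{b,c\}\!\}_{\delta_1\delta_2}=\delta_2(c)'\delta_1(b)''\otimes\delta_1(b)'\delta_2(c)''-\delta_1(c)'\delta_2(b)''\otimes\delta_2(b)'\delta_1(c)''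 .$$ Let $\{\!\{-,-\}\!\}$ be the double quasi-Poisson bracket on $A$ defined in this way, by linearity, from $$P=\frac12\sum_{a\in\bar Q}\epsilon(a)(1+a^*a)\frac{\partial}{\partial a}\frac{\partial}{\partial a^*}-\frac12\sum_{\substack{a,b\in\bar Q\\ t(a)=t(b),\,a<b}}\Big(\frac{\partial}{\partial a^*}a^*-a\frac{\partial}{\partial a}\Big)\Big(\frac{\partial}{\partial b^*}b^*-b\frac{\partial}{\partial b}\Big),$$ let $\{b,c\}=\{\!\{b,c\}\!\}'\{\!\{b,c\}\!\}''$ be the associated bracket $A\times A\to A$, and let $[A,A]$ be the linear span of all commutators $bc-cb$ ($b,c\in A$). Let $\phi=\sum_{s\in I}\phi_s$ with $\phi_s=(e_s+x_sy_s)(e_s+y_{s-1}x_{s-1})^{-1}$, where the inverse is taken in $e_sAe_s$, let $\phi^{-1}=\sum_{s\in I}\phi_s^{-1}$ with $\phi_s^{-1}$ the inverse of $\phi_s$ in $e_sAe_s$, and for $\eta\in\mathbb C$ put $$U_{+,\eta}=u(1+\eta\phi),\qquad U_{-,\eta}=u(1+\eta\phi^{-1}).$$ Proposition. For all integers $K,L\ge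 1$ and all $\eta,\eta'\in\mathbb C$: if $\epsilon(u)=-1$, then $\{U_{+,\eta}^K,U_{+,\eta'}^L\}\in[A,A]$; if $\epsilon(u)=+1$, then $\{U_{-,\eta}^K,U_{-,\eta'}^L\}\in[A,A]$. -/

import Mathlib

open scoped TensorProduct

noncomputable section

namespace SpinCyclic

/-! ### The doubled spin cyclic quiver -/

/-- Vertices `I ∪ {∞}` with `I = ℤ/mℤ`: `some s` is the vertex `s ∈ I`, `none` is `∞`. -/
abbrev Vertex (m : ℕ) : Type := Option (ZMod m)

/-- Arrows of the doubled quiver: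
`x s : s → s+1`, `y s = (x s)* : s+1 → s`, `v α : ∞ → 0`, `w α = (v α)* : 0 → ∞`. -/
inductive Arrow (m d : ℕ) : Type
  | x (s : ZMod m)
  | y (s : ZMod m)
  | v (α : Fin d)
  | w (α : Fin d)
  deriving DecidableEq

namespace Arrow

variable {m d : ℕ}

/-- The arrows, listed by kind. -/
def equivSum : Arrow m d ≃ (ZMod m ⊕ ZMod m) ⊕ (Fin d ⊕ Fin d) where
  toFun
    | x s => .inl (.inl s)
    | y s => .inl (.inr s)
    | v α => .inr (.inl α)
    | w α => .inr (.inr α)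
  invFun
    | .inl (.inl s) => x s
    | .inl (.inr s) => y s
    | .inr (.inl α) => v α
    | .inr (.inr α) => w α
  left_inv a := by cases a <;> rfl
  right_inv a := by rcases a with (a | a) | (a | a) <;> rfl

instance [NeZero m] : Fintype (Arrow m d) := Fintype.ofEquiv _ equivSum.symm

/-- The tail (starting vertex) of an arrow. -/
def tail : Arrow m d → Vertex m
  | x s => some s
  | y s => some (s + 1)
  | v _ => none
  | w _ => some 0

/-- The head (end vertex) of an arrow. -/
def head : Arrow m d → Vertex m
  | x s => some (s + 1)
  | y s => some s
  | v _ => some 0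
  | w _ => none

/-- The involution `a ↦ a*`. -/
def star : Arrow m d → Arrow m d
  | x s => y s
  | y s => x s
  | v α => w α
  | w α => v α

lemma head_star (a : Arrow m d) : a.star.head = a.tail := by
  cases a <;> rfl

/-- `ε(a) = +1` for the arrows `x s`, `v α` of the original quiver, `-1` for their doubles. -/
def sign : Arrow m d → ℂ
  | x _ => 1
  | y _ => -1
  | v _ => 1
  | w _ => -1

/-- The ordering of the arrows with a common tail. At `∞` it is `v₁ < ⋯ < v_d`, at `s ≠ 0` in `I`
it is `x_s < y_{s-1}`, and at `0` it is `x_0 < y_{m-1} < w₁ < ⋯ < w_d`.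
(It is only ever used for two arrows with the same tail.) -/
def lt : Arrow m d → Arrow m d → Prop
  | x _, y _ => True
  | x _, w _ => True
  | y _, w _ => True
  | v α, v β => α < β
  | w α, w β => α < β
  | _, _ => False

end Arrow

/-! ### The localised path algebra -/

/-- Generators: trivial paths `e_s`, arrows `a`, the inverses `(1 + a a*)⁻¹`,
and local inverses `a⁻¹` of the arrows `a ∈ S`. -/
inductive Gen (m d : ℕ) (S : Set (Arrow m d)) : Type
  | e (s : Vertex m)
  | arr (a : Arrow m d)
  | inv (a : Arrow m d)
  | linv (a : S)

/-- The relations. The first five present the path algebra of the doubled quiver (paths are written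
from left to right), the next two make each `1 + a a*` invertible, and the last four say that
`a⁻¹ = e_{h(a)} a⁻¹ e_{t(a)}`, `a a⁻¹ = e_{t(a)}` and `a⁻¹ a = e_{h(a)}` for `a ∈ S`. -/
inductive Rel (m d : ℕ) [NeZero m] (S : Set (Arrow m d)) :
    FreeAlgebra ℂ (Gen m d S) → FreeAlgebra ℂ (Gen m d S) → Prop
  | idem (s : Vertex m) :
      Rel m d S (FreeAlgebra.ι ℂ (.e s) * FreeAlgebra.ι ℂ (.e s)) (FreeAlgebra.ι ℂ (.e s))
  | orth (r s : Vertex m) (h : r ≠ s) :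
      Rel m d S (FreeAlgebra.ι ℂ (.e r) * FreeAlgebra.ι ℂ (.e s)) 0
  | sum_e : Rel m d S (∑ s : Vertex m, FreeAlgebra.ι ℂ (.e s)) 1
  | tail_mul (a : Arrow m d) :
      Rel m d S (FreeAlgebra.ι ℂ (.e a.tail) * FreeAlgebra.ι ℂ (.arr a)) (FreeAlgebra.ι ℂ (.arr a))
  | mul_head (a : Arrow m d) :
      Rel m d S (FreeAlgebra.ι ℂ (.arr a) * FreeAlgebra.ι ℂ (.e a.head)) (FreeAlgebra.ι ℂ (.arr a))
  | mul_inv (a : Arrow m d) :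
      Rel m d S ((1 + FreeAlgebra.ι ℂ (.arr a) * FreeAlgebra.ι ℂ (.arr a.star)) *
        FreeAlgebra.ι ℂ (.inv a)) 1
  | inv_mul (a : Arrow m d) :
      Rel m d S (FreeAlgebra.ι ℂ (.inv a) *
        (1 + FreeAlgebra.ι ℂ (.arr a) * FreeAlgebra.ι ℂ (.arr a.star))) 1
  | head_linv (a : S) :
      Rel m d S (FreeAlgebra.ι ℂ (.e a.1.head) * FreeAlgebra.ι ℂ (.linv a))
        (FreeAlgebra.ι ℂ (.linv a))
  | linv_tail (a : S) :
      Rel m d S (FreeAlgebra.ι ℂ (.linv a) * FreeAlgebra.ι ℂ (.e a.1.tail))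
        (FreeAlgebra.ι ℂ (.linv a))
  | mul_linv (a : S) :
      Rel m d S (FreeAlgebra.ι ℂ (.arr a.1) * FreeAlgebra.ι ℂ (.linv a))
        (FreeAlgebra.ι ℂ (.e a.1.tail))
  | linv_mul (a : S) :
      Rel m d S (FreeAlgebra.ι ℂ (.linv a) * FreeAlgebra.ι ℂ (.arr a.1))
        (FreeAlgebra.ι ℂ (.e a.1.head))

/-- The path algebra of the doubled spin cyclic quiver in which all `1 + a a*` are inverted and
the arrows in `S` are locally inverted. -/
def PathAlg (m d : ℕ) [NeZero m] (S : Set (Arrow m d)) : Type := RingQuot (Rel m d S)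

instance (m d : ℕ) [NeZero m] (S : Set (Arrow m d)) : Ring (PathAlg m d S) :=
  inferInstanceAs (Ring (RingQuot (Rel m d S)))

instance (m d : ℕ) [NeZero m] (S : Set (Arrow m d)) : Algebra ℂ (PathAlg m d S) :=
  inferInstanceAs (Algebra ℂ (RingQuot (Rel m d S)))

section Elements

variable {m d : ℕ} [NeZero m] {S : Set (Arrow m d)}

/-- The quotient map from the free algebra. -/
def mk : FreeAlgebra ℂ (Gen m d S) →ₐ[ℂ] PathAlg m d S := RingQuot.mkAlgHom ℂ (Rel m d S)

/-- The image of a generator in the algebra. -/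
def gen (g : Gen m d S) : PathAlg m d S := mk (FreeAlgebra.ι ℂ g)

/-- The trivial path `e_s`. -/
def e (s : Vertex m) : PathAlg m d S := gen (.e s)

/-- The arrow `a` as an element of the algebra. -/
def arr (a : Arrow m d) : PathAlg m d S := gen (.arr a)

/-- The inverse `(1 + a a*)⁻¹`. -/
def inv (a : Arrow m d) : PathAlg m d S := gen (.inv a)

/-- The local inverse `a⁻¹` of an arrow `a ∈ S`. -/
def linv (a : S) : PathAlg m d S := gen (.linv a)

lemma mk_eq_of_rel {p q : FreeAlgebra ℂ (Gen m d S)} (h : Rel m d S p q) :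
    mk p = mk q :=
  RingQuot.mkAlgHom_rel ℂ h

lemma e_mul_self (s : Vertex m) : (e s * e s : PathAlg m d S) = e s := by
  simpa [e, gen] using mk_eq_of_rel (Rel.idem (S := S) s)

lemma e_mul_of_ne {r s : Vertex m} (h : r ≠ s) : (e r * e s : PathAlg m d S) = 0 := by
  simpa [e, gen] using mk_eq_of_rel (Rel.orth (S := S) r s h)

lemma sum_e : (∑ s : Vertex m, e s : PathAlg m d S) = 1 := by
  have h := mk_eq_of_rel (Rel.sum_e (S := S))
  rw [map_sum, map_one] at h
  exact h

lemma e_tail_mul (a : Arrow m d) : (e a.tail * arr a : PathAlg m d S) = arr a := by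
  simpa [e, arr, gen] using mk_eq_of_rel (Rel.tail_mul (S := S) a)

lemma mul_e_head (a : Arrow m d) : (arr a * e a.head : PathAlg m d S) = arr a := by
  simpa [e, arr, gen] using mk_eq_of_rel (Rel.mul_head (S := S) a)

lemma mul_inv (a : Arrow m d) : ((1 + arr a * arr a.star) * inv a : PathAlg m d S) = 1 := by
  simpa [inv, arr, gen] using mk_eq_of_rel (Rel.mul_inv (S := S) a)

lemma inv_mul (a : Arrow m d) : (inv a * (1 + arr a * arr a.star) : PathAlg m d S) = 1 := by
  simpa [inv, arr, gen] using mk_eq_of_rel (Rel.inv_mul (S := S) a)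

lemma e_head_linv (a : S) : (e a.1.head * linv a : PathAlg m d S) = linv a := by
  simpa [e, linv, gen] using mk_eq_of_rel (Rel.head_linv (S := S) a)

lemma linv_e_tail (a : S) : (linv a * e a.1.tail : PathAlg m d S) = linv a := by
  simpa [e, linv, gen] using mk_eq_of_rel (Rel.linv_tail (S := S) a)

lemma mul_linv (a : S) : (arr a.1 * linv a : PathAlg m d S) = e a.1.tail := by
  simpa [e, arr, linv, gen] using mk_eq_of_rel (Rel.mul_linv (S := S) a)

lemma linv_mul (a : S) : (linv a * arr a.1 : PathAlg m d S) = e a.1.head := by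
  simpa [e, arr, linv, gen] using mk_eq_of_rel (Rel.linv_mul (S := S) a)

end Elements

/-! ### The double derivations `∂/∂a` -/

section Derivation

variable {m d : ℕ} [NeZero m] {S : Set (Arrow m d)}

/-- `2 × 2` matrices over `A ⊗ A`. -/
abbrev Mat2 (m d : ℕ) [NeZero m] (S : Set (Arrow m d)) : Type :=
  Matrix (Fin 2) (Fin 2) (PathAlg m d S ⊗[ℂ] PathAlg m d S)

/-- The matrix `[[b ⊗ 1, t], [0, 1 ⊗ b]]`. -/
def jet (b : PathAlg m d S) (t : PathAlg m d S ⊗[ℂ] PathAlg m d S) : Mat2 m d S :=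
  !![b ⊗ₜ 1, t; 0, 1 ⊗ₜ b]

lemma jet_mul (b c : PathAlg m d S) (t r : PathAlg m d S ⊗[ℂ] PathAlg m d S) :
    jet b t * jet c r = jet (b * c) ((b ⊗ₜ 1) * r + t * (1 ⊗ₜ c)) := by
  simp [jet, Algebra.TensorProduct.tmul_mul_tmul]

lemma jet_add (b c : PathAlg m d S) (t r : PathAlg m d S ⊗[ℂ] PathAlg m d S) :
    jet b t + jet c r = jet (b + c) (t + r) := by
  ext i j; fin_cases i <;> fin_cases j <;>
    simp [jet, TensorProduct.add_tmul, TensorProduct.tmul_add]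

lemma jet_one : jet (1 : PathAlg m d S) 0 = 1 := by
  ext i j; fin_cases i <;> fin_cases j <;> simp [jet, Algebra.TensorProduct.one_def]

lemma jet_zero : jet (0 : PathAlg m d S) 0 = 0 := by
  ext i j; fin_cases i <;> fin_cases j <;> simp [jet]

lemma jet_sum {ι : Type} (F : Finset ι) (b : ι → PathAlg m d S) :
    ∑ i ∈ F, jet (b i) 0 = jet (∑ i ∈ F, b i) 0 := by
  classical
  induction F using Finset.induction_on with
  | empty => simp [jet_zero]
  | insert i F hi ih => rw [Finset.sum_insert hi, Finset.sum_insert hi, ih, jet_add, add_zero]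

/-- The value `∂b/∂a` on an arrow `b`. -/
def partialArr (a b : Arrow m d) : PathAlg m d S ⊗[ℂ] PathAlg m d S :=
  if a = b then e a.tail ⊗ₜ e a.head else 0

/-- The value of `∂/∂a` on a generator: zero on the `e_s`, and on inverses as the Leibniz rule
dictates. -/
def partialGen (a : Arrow m d) : Gen m d S → PathAlg m d S ⊗[ℂ] PathAlg m d S
  | .e _ => 0
  | .arr b => partialArr a b
  | .inv b => -((inv b ⊗ₜ 1) * ((arr b ⊗ₜ 1) * partialArr a b.star +
      partialArr a b * (1 ⊗ₜ arr b.star)) * (1 ⊗ₜ inv b))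
  | .linv b => -((linv b ⊗ₜ 1) * partialArr a b.1 * (1 ⊗ₜ linv b))

/-- On generators, the algebra map `b ↦ [[b ⊗ 1, ∂b/∂a], [0, 1 ⊗ b]]`. -/
def jetFree (a : Arrow m d) : FreeAlgebra ℂ (Gen m d S) →ₐ[ℂ] Mat2 m d S :=
  FreeAlgebra.lift ℂ fun g => jet (gen g) (partialGen a g)

lemma jetFree_ι (a : Arrow m d) (g : Gen m d S) :
    jetFree a (FreeAlgebra.ι ℂ g) = jet (gen g) (partialGen a g) := by
  simp [jetFree]

lemma tail_partialArr (a b : Arrow m d) :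
    (e b.tail ⊗ₜ 1) * partialArr a b = (partialArr a b : PathAlg m d S ⊗[ℂ] PathAlg m d S) := by
  unfold partialArr
  split_ifs with h
  · subst h; simp [Algebra.TensorProduct.tmul_mul_tmul, e_mul_self]
  · simp

lemma partialArr_head (a b : Arrow m d) :
    partialArr a b * (1 ⊗ₜ e b.head) = (partialArr a b : PathAlg m d S ⊗[ℂ] PathAlg m d S) := by
  unfold partialArr
  split_ifs with h
  · subst h; simp [Algebra.TensorProduct.tmul_mul_tmul, e_mul_self]
  · simp

lemma jetFree_rel (a : Arrow m d) {p q : FreeAlgebra ℂ (Gen m d S)} (h : Rel m d S p q) :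
    jetFree a p = jetFree a q := by
  have tl (b c : PathAlg m d S) : (b ⊗ₜ[ℂ] (1 : PathAlg m d S)) * (c ⊗ₜ 1) = (b * c) ⊗ₜ 1 := by simp
  have tr (b c : PathAlg m d S) : ((1 : PathAlg m d S) ⊗ₜ[ℂ] b) * (1 ⊗ₜ c) = 1 ⊗ₜ (b * c) := by simp
  cases h with
  | idem s =>
    simp only [map_mul, jetFree_ι, jet_mul, partialGen, mul_zero, zero_mul, add_zero]
    exact congrArg (jet · 0) (e_mul_self s)
  | orth r s h =>
    simp only [map_mul, map_zero, jetFree_ι, jet_mul, partialGen, mul_zero, zero_mul, add_zero]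
    exact (congrArg (jet · 0) (e_mul_of_ne h)).trans jet_zero
  | sum_e =>
    simp only [map_sum, map_one, jetFree_ι, partialGen, jet_sum]
    exact (congrArg (jet · 0) sum_e).trans jet_one
  | tail_mul b =>
    simp only [map_mul, jetFree_ι, jet_mul, partialGen, zero_mul, add_zero]
    exact congrArg₂ jet (e_tail_mul b) (tail_partialArr a b)
  | mul_head b =>
    simp only [map_mul, jetFree_ι, jet_mul, partialGen, mul_zero, zero_add]
    exact congrArg₂ jet (mul_e_head b) (partialArr_head a b)
  | mul_inv b =>
    simp only [map_mul, map_add, map_one, jetFree_ι, ← jet_one, jet_mul, jet_add, partialGen]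
    refine congrArg₂ jet (mul_inv b) ?_
    change ((1 + arr b * arr b.star) ⊗ₜ 1) * _ + (0 + _) * (1 ⊗ₜ inv b) = _
    rw [zero_add, mul_neg, ← mul_assoc, ← mul_assoc, tl, mul_inv]
    rw [← Algebra.TensorProduct.one_def, one_mul]
    exact neg_add_cancel _
  | inv_mul b =>
    simp only [map_mul, map_add, map_one, jetFree_ι, ← jet_one, jet_mul, jet_add, partialGen]
    refine congrArg₂ jet (inv_mul b) ?_
    change (inv b ⊗ₜ 1) * (0 + _) + _ * (1 ⊗ₜ (1 + arr b * arr b.star)) = _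
    rw [zero_add, neg_mul, mul_assoc _ (1 ⊗ₜ inv b), tr, inv_mul]
    rw [← Algebra.TensorProduct.one_def, mul_one]
    exact add_neg_cancel _
  | head_linv b =>
    simp only [map_mul, jetFree_ι, jet_mul, partialGen, zero_mul, add_zero]
    refine congrArg₂ jet (e_head_linv b) ?_
    change (e b.1.head ⊗ₜ 1) * _ = _
    rw [mul_neg, ← mul_assoc, ← mul_assoc, tl, e_head_linv]
  | linv_tail b =>
    simp only [map_mul, jetFree_ι, jet_mul, partialGen, mul_zero, zero_add]
    refine congrArg₂ jet (linv_e_tail b) ?_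
    change _ * (1 ⊗ₜ e b.1.tail) = _
    rw [neg_mul, mul_assoc, tr, linv_e_tail]
  | mul_linv b =>
    simp only [map_mul, jetFree_ι, jet_mul, partialGen]
    refine congrArg₂ jet (mul_linv b) ?_
    change (arr b.1 ⊗ₜ 1) * _ + _ * (1 ⊗ₜ linv b) = _
    rw [mul_neg, ← mul_assoc, ← mul_assoc, tl, mul_linv, tail_partialArr]
    exact neg_add_cancel _
  | linv_mul b =>
    simp only [map_mul, jetFree_ι, jet_mul, partialGen]
    refine congrArg₂ jet (linv_mul b) ?_
    change (linv b ⊗ₜ 1) * _ + _ * (1 ⊗ₜ arr b.1) = _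
    rw [neg_mul, mul_assoc _ (1 ⊗ₜ linv b), tr, linv_mul, mul_assoc, partialArr_head]
    exact add_neg_cancel _

/-- The algebra map `A → Mat₂(A ⊗ A)`, `b ↦ [[b ⊗ 1, ∂b/∂a], [0, 1 ⊗ b]]`. -/
def jetHom (a : Arrow m d) : PathAlg m d S →ₐ[ℂ] Mat2 m d S :=
  show RingQuot (Rel m d S) →ₐ[ℂ] Mat2 m d S from
  RingQuot.liftAlgHom ℂ ⟨jetFree a, fun _ _ h => jetFree_rel a h⟩

/-- The double derivation `∂/∂a : A → A ⊗ A`, that is the derivation for the outer bimodule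
structure on `A ⊗ A` which vanishes on the `e_s` and has `∂b/∂a = δ_{ab} e_{t(a)} ⊗ e_{h(a)}` for
arrows `b`. -/
def partialD (a : Arrow m d) : PathAlg m d S →ₗ[ℂ] PathAlg m d S ⊗[ℂ] PathAlg m d S :=
  Matrix.entryLinearMap ℂ _ 0 1 ∘ₗ (jetHom a).toLinearMap

lemma jetHom_mk (a : Arrow m d) (p : FreeAlgebra ℂ (Gen m d S)) :
    jetHom a (mk p) = jetFree a p :=
  RingQuot.liftAlgHom_mkAlgHom_apply ℂ (jetFree a) (fun _ _ h => jetFree_rel a h) p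

lemma jetHom_gen (a : Arrow m d) (g : Gen m d S) :
    jetHom a (gen g) = jet (gen g) (partialGen a g) := by
  rw [gen, jetHom_mk, jetFree_ι, gen]

lemma jetHom_eq (a : Arrow m d) (b : PathAlg m d S) : jetHom a b = jet b (partialD a b) := by
  obtain ⟨p, rfl⟩ : ∃ p, mk p = b := RingQuot.mkAlgHom_surjective ℂ (Rel m d S) b
  suffices ∃ t, jetHom a (mk p) =
      jet (mk p) t by
    obtain ⟨t, ht⟩ := this
    have : partialD a (mk p) = t := by
      change jetHom a _ 0 1 = _
      rw [ht]; rfl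
    rw [this, ht]
  induction p using FreeAlgebra.induction with
  | grade0 r =>
    refine ⟨0, ?_⟩
    rw [AlgHom.commutes, AlgHom.commutes]
    ext i j
    fin_cases i <;> fin_cases j <;>
      simp [jet, Matrix.algebraMap_matrix_apply, Algebra.TensorProduct.algebraMap_apply]
    rw [Algebra.algebraMap_eq_smul_one, TensorProduct.smul_tmul]
  | grade1 g => exact ⟨_, jetHom_gen a g⟩
  | mul p q hp hq =>
    obtain ⟨t, ht⟩ := hp
    obtain ⟨r, hr⟩ := hq
    exact ⟨_, by rw [map_mul, map_mul, ht, hr, jet_mul]⟩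
  | add p q hp hq =>
    obtain ⟨t, ht⟩ := hp
    obtain ⟨r, hr⟩ := hq
    exact ⟨_, by rw [map_add, map_add, ht, hr, jet_add]⟩

/-- The Leibniz rule `∂(bc) = b ∂(c) + ∂(b) c` for the outer bimodule structure. -/
lemma partialD_mul (a : Arrow m d) (b c : PathAlg m d S) :
    partialD a (b * c) = (b ⊗ₜ 1) * partialD a c + partialD a b * (1 ⊗ₜ c) := by
  have h := jetHom_eq a (b * c)
  rw [map_mul, jetHom_eq, jetHom_eq, jet_mul] at h
  simpa [jet] using (congrFun (congrFun h 0) 1).symm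

lemma partialD_gen (a : Arrow m d) (g : Gen m d S) : partialD a (gen g) = partialGen a g := by
  change jetHom a _ 0 1 = _
  rw [jetHom_gen]; rfl

lemma partialD_e (a : Arrow m d) (s : Vertex m) :
    partialD a (e s : PathAlg m d S) = 0 := partialD_gen a _

lemma partialD_arr (a b : Arrow m d) :
    partialD a (arr b : PathAlg m d S) = if a = b then e a.tail ⊗ₜ e a.head else 0 :=
  partialD_gen a _

end Derivation

/-! ### The double bracket -/

section Bracket

variable {m d : ℕ} [NeZero m] {S : Set (Arrow m d)}

/-- The inner bimodule structure on `A ⊗ A`: `b ∗ (t' ⊗ t'') ∗ c = t' c ⊗ b t''`. -/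
def inner (b c : PathAlg m d S) :
    PathAlg m d S ⊗[ℂ] PathAlg m d S →ₗ[ℂ] PathAlg m d S ⊗[ℂ] PathAlg m d S :=
  TensorProduct.map (LinearMap.mulRight ℂ c) (LinearMap.mulLeft ℂ b)

lemma inner_tmul (b c p q : PathAlg m d S) : inner b c (p ⊗ₜ q) = (p * c) ⊗ₜ (b * q) := by
  simp [inner]

/-- The bimodule structure on double derivations, `(b δ c)(f) = b ∗ δ(f) ∗ c`. -/
def bimod (b : PathAlg m d S) (δ : PathAlg m d S →ₗ[ℂ] PathAlg m d S ⊗[ℂ] PathAlg m d S)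
    (c : PathAlg m d S) : PathAlg m d S →ₗ[ℂ] PathAlg m d S ⊗[ℂ] PathAlg m d S :=
  inner b c ∘ₗ δ

/-- The bilinear map `(p' ⊗ p'', q' ⊗ q'') ↦ q' p'' ⊗ p' q''`. -/
def mix (p q : PathAlg m d S ⊗[ℂ] PathAlg m d S) : PathAlg m d S ⊗[ℂ] PathAlg m d S :=
  TensorProduct.map₂ (LinearMap.mul ℂ (PathAlg m d S)).flip (LinearMap.mul ℂ (PathAlg m d S))
    (TensorProduct.comm ℂ _ _ p) q

lemma mix_tmul (p₁ p₂ q₁ q₂ : PathAlg m d S) :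
    mix (p₁ ⊗ₜ p₂) (q₁ ⊗ₜ q₂) = (q₁ * p₂) ⊗ₜ (p₁ * q₂) := by
  simp [mix]

/-- The double bracket defined by the product `δ₁ δ₂` of two double derivations:
`{{b, c}} = δ₂(c)' δ₁(b)'' ⊗ δ₁(b)' δ₂(c)'' - δ₁(c)' δ₂(b)'' ⊗ δ₂(b)' δ₁(c)''`. -/
def biBracket (δ₁ δ₂ : PathAlg m d S →ₗ[ℂ] PathAlg m d S ⊗[ℂ] PathAlg m d S)
    (b c : PathAlg m d S) : PathAlg m d S ⊗[ℂ] PathAlg m d S :=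
  mix (δ₁ b) (δ₂ c) - mix (δ₂ b) (δ₁ c)

/-- The double derivation `∂/∂a* a* - a ∂/∂a`. -/
def eulerD (a : Arrow m d) : PathAlg m d S →ₗ[ℂ] PathAlg m d S ⊗[ℂ] PathAlg m d S :=
  (bimod 1 (partialD a.star) (arr a.star) : PathAlg m d S →ₗ[ℂ] PathAlg m d S ⊗[ℂ] PathAlg m d S)
    - bimod (arr a) (partialD a) 1

open scoped Classical in
/-- The double quasi-Poisson bracket of the spin cyclic quiver, defined by the bivector
`P = ½ ∑_a ε(a) (1 + a* a) ∂/∂a ∂/∂a*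
  - ½ ∑_{t(a) = t(b), a < b} (∂/∂a* a* - a ∂/∂a) (∂/∂b* b* - b ∂/∂b)`,
where `a`, `b` run through all arrows of the doubled quiver. -/
def doubleBracket (b c : PathAlg m d S) : PathAlg m d S ⊗[ℂ] PathAlg m d S :=
  (1 / 2 : ℂ) • ∑ a : Arrow m d, a.sign •
      biBracket (bimod (1 + arr a.star * arr a) (partialD a) 1) (partialD a.star) b c
  - (1 / 2 : ℂ) • ∑ a : Arrow m d, ∑ a' : Arrow m d,
      if a.tail = a'.tail ∧ a.lt a' then biBracket (eulerD a) (eulerD a') b c else 0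

/-- The associated bracket `{b, c} = {{b, c}}' {{b, c}}''`. -/
def bracket (b c : PathAlg m d S) : PathAlg m d S :=
  LinearMap.mul' ℂ (PathAlg m d S) (doubleBracket b c)

/-- The linear subspace `[A, A]` spanned by the commutators. -/
def commutators (m d : ℕ) [NeZero m] (S : Set (Arrow m d)) : Submodule ℂ (PathAlg m d S) :=
  Submodule.span ℂ {f | ∃ b c : PathAlg m d S, f = b * c - c * b}

/-- The moment map of the cycle, `φ = ∑_s φ_s` with
`φ_s = (e_s + x_s y_s) (e_s + y_{s-1} x_{s-1})⁻¹`,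
the local inverse being `e_s (1 + y_{s-1} x_{s-1})⁻¹ e_s`. -/
def phi : PathAlg m d S :=
  ∑ s : ZMod m, (e (some s) + arr (.x s) * arr (.y s)) *
    (e (some s) * inv (.y (s - 1)) * e (some s))

/-- The local inverse `φ⁻¹ = ∑_s (e_s + y_{s-1} x_{s-1}) (e_s + x_s y_s)⁻¹`. -/
def phiInv : PathAlg m d S :=
  ∑ s : ZMod m, (e (some s) + arr (.y (s - 1)) * arr (.x (s - 1))) *
    (e (some s) * inv (.x s) * e (some s))

/-- The element `e_{t(a)} (1 + a a*)⁻¹ e_{t(a)}` is the local inverse of `e_{t(a)} + a a*`. -/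
lemma local_inv (a : Arrow m d) :
    ((e a.tail + arr a * arr a.star) * (e a.tail * inv a * e a.tail) : PathAlg m d S) = e a.tail ∧
    (e a.tail * inv a * e a.tail * (e a.tail + arr a * arr a.star) : PathAlg m d S) =
      e a.tail := by
  have h1 : (e a.tail * (arr a * arr a.star) : PathAlg m d S) = arr a * arr a.star := by
    rw [← mul_assoc, e_tail_mul]
  have h2 : (arr a * arr a.star * e a.tail : PathAlg m d S) = arr a * arr a.star := by
    have h := mul_e_head (S := S) a.star
    rw [Arrow.head_star] at h
    rw [mul_assoc, h]
  have h3 : (e a.tail + arr a * arr a.star : PathAlg m d S) =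
      e a.tail * (1 + arr a * arr a.star) := by rw [mul_add, mul_one, h1]
  have h4 : (e a.tail + arr a * arr a.star : PathAlg m d S) =
      (1 + arr a * arr a.star) * e a.tail := by rw [add_mul, one_mul, h2]
  constructor
  · rw [← mul_assoc, ← mul_assoc, add_mul, e_mul_self, h2, h3, mul_assoc (e a.tail), mul_inv,
      mul_one, e_mul_self]
  · rw [mul_assoc, mul_add, e_mul_self, h1, h4, mul_assoc (e a.tail), ← mul_assoc (inv a), inv_mul,
      one_mul, e_mul_self]

lemma sum_mul_sum_corner (f g : ZMod m → PathAlg m d S)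
    (hf : ∀ s, f s * e (some s) = f s) (hg : ∀ s, e (some s) * g s = g s)
    (hfg : ∀ s, f s * g s = e (some s)) :
    (∑ s, f s) * ∑ s, g s = ∑ s : ZMod m, e (some s) := by
  rw [Finset.sum_mul_sum]
  refine Finset.sum_congr rfl fun s _ => ?_
  rw [Finset.sum_eq_single s]
  · exact hfg s
  · intro r _ hr
    rw [← hf s, ← hg r, mul_assoc, ← mul_assoc (e (some s)),
      e_mul_of_ne (fun h => hr (Option.some.inj h).symm), zero_mul, mul_zero]
  · simp

/-- `φ` and `φ⁻¹` are inverse to each other in `e A e` for `e = ∑_{s ∈ I} e_s`. -/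
lemma phi_phiInv :
    (phi * phiInv : PathAlg m d S) = ∑ s : ZMod m, e (some s) ∧
    (phiInv * phi : PathAlg m d S) = ∑ s : ZMod m, e (some s) := by
  have hx (s : ZMod m) := local_inv (S := S) (.x s)
  have hy (s : ZMod m) := local_inv (S := S) (.y (s - 1))
  simp only [Arrow.tail, Arrow.star, sub_add_cancel] at hx hy
  have ex (s : ZMod m) : (e (some s) * arr (.x s) : PathAlg m d S) = arr (.x s) :=
    e_tail_mul (.x s)
  have ey (s : ZMod m) : (e (some s) * arr (.y (s - 1)) : PathAlg m d S) = arr (.y (s - 1)) := by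
    have := e_tail_mul (S := S) (.y (s - 1))
    simpa only [Arrow.tail, sub_add_cancel] using this
  constructor
  · refine sum_mul_sum_corner _ _ (fun s => ?_) (fun s => ?_) fun s => ?_
    · simp only [mul_assoc, e_mul_self]
    · rw [← mul_assoc (e (some s)), mul_add, e_mul_self, ← mul_assoc (e (some s)) (arr _), ey]
    · rw [mul_assoc, ← mul_assoc _ (e (some s) + _), (hy s).2, ← mul_assoc (e (some s)),
        ← mul_assoc (e (some s)), e_mul_self, (hx s).1]
  · refine sum_mul_sum_corner _ _ (fun s => ?_) (fun s => ?_) fun s => ?_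
    · simp only [mul_assoc, e_mul_self]
    · rw [← mul_assoc (e (some s)), mul_add, e_mul_self, ← mul_assoc (e (some s)) (arr _), ex]
    · rw [mul_assoc, ← mul_assoc _ (e (some s) + _), (hx s).2, ← mul_assoc (e (some s)),
        ← mul_assoc (e (some s)), e_mul_self, (hy s).1]

end Bracket

/-! ### The elements `u` -/

/-- The four choices `x`, `y`, `z`, `∑ e_s + xy` for `u`. -/
inductive Letter : Type
  | x
  | y
  | z
  | exy

namespace Letter

/-- `ε(u)`. -/
def sign : Letter → ℤ
  | x => 1
  | y => -1
  | z => -1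
  | exy => 1

/-- The arrows which have to be locally inverted in order to localise at `u`: all the `x_s` for
`u = x`, all the `y_s` for `u = y`. For `u = z` the `x_s` are inverted in order to define
`z_s = y_s + x_s⁻¹`, which then has the local inverse `(e_s + x_s y_s)⁻¹ x_s`; and `∑ e_s + xy` is
already locally invertible. -/
def inverted (m d : ℕ) : Letter → Set (Arrow m d)
  | x => Set.range Arrow.x
  | y => Set.range Arrow.y
  | z => Set.range Arrow.x
  | exy => ∅

/-- The algebra localised at `u`. -/
abbrev Alg (m d : ℕ) [NeZero m] (u : Letter) : Type := PathAlg m d (u.inverted m d)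

/-- The element `u` itself: `x = ∑ x_s`, `y = ∑ y_s`, `z = ∑ (y_s + x_s⁻¹)`, `∑ e_s + xy`. -/
def elt (m d : ℕ) [NeZero m] : (u : Letter) → Alg m d u
  | x => ∑ s : ZMod m, arr (.x s)
  | y => ∑ s : ZMod m, arr (.y s)
  | z => ∑ s : ZMod m, (arr (.y s) + linv ⟨.x s, Set.mem_range_self s⟩)
  | exy => ∑ s : ZMod m, e (some s) + (∑ s : ZMod m, arr (.x s)) * ∑ s : ZMod m, arr (.y s)

/-- `U_{+,η} = u (1 + η φ)`. -/
def UPlus (m d : ℕ) [NeZero m] (u : Letter) (η : ℂ) : Alg m d u := u.elt m d * (1 + η • phi)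

/-- `U_{-,η} = u (1 + η φ⁻¹)`. -/
def UMinus (m d : ℕ) [NeZero m] (u : Letter) (η : ℂ) : Alg m d u := u.elt m d * (1 + η • phiInv)

end Letter

end SpinCyclic

end

/-!
Write `l(b) = b ⊗ 1` and `r(b) = 1 ⊗ b` for the two commuting embeddings of `A` into the ring
`A ⊗ A`. The outer and inner bimodule structures are then left and right multiplications in
`A ⊗ A`, and the idempotents `e_s` in the formulas for double brackets are collected in
`F_k = ∑ e_{s+k} ⊗ e_s`. A homogeneous element `f` (`f e_s = e_{s+k} f`, for a fixed shift `k`)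
moves past the `F_j` up to a shift of `j`, so every computation of a double bracket is a normal form
computation in `A ⊗ A`.

On elements which do not involve the `v_α`, `w_α` the double bracket is the one of the doubled
cyclic quiver. Its values on `x` and `y` are computed from the definition, and give the first two
of the following facts; the third holds for every double bracket.
* `φ` has the moment map property `{{φ, a}} = ½ (a G - G a)`, `G = (l(φ) + r(φ)) F_0`, at every
  element `a` generated by `x`, `y` and local inverses (`IsMomentAt`). It is enough to check this at
  `x` and `y`, since both sides are derivations in `a`. The inverse `φ⁻¹` has the same property for
  the opposite bracket.
* `{{u, u}} = ½ ε(u) (l(u) F_0 l(u) - r(u) F_0 r(u))` for each of the four choices of `u`.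
* Modulo commutators, `{U^K, V^L} = K L {{U, V}}' U^{K-1} {{U, V}}'' V^{L-1}` (`cyc_bracket_pow`).

After passing to the opposite bracket and `φ⁻¹` if `ε(u) = 1`, the two cases become one: `g = φ` or
`g = φ⁻¹`, `W = u g`, `U = u + η W`, `V = u + η' W`. The signs of `{{u, u}}` and of the moment map
property are such that all terms of `{{U, V}}` are products of two elements `u`, `W`
(`bracket_U_V`). If `η = η'`, the resulting element of `A / [A, A]` vanishes by cyclicity. If
`η ≠ η'`, then `u` and `W` are linear combinations of `U` and `V`, and the element becomes a linear
combination of the classes of `U^{K+1} V^{L-1}`, `U^K V^L`, `U^{K-1} V^{L+1}`, with coefficients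
zero (`cyc_identity`).
-/

open scoped TensorProduct

noncomputable section

namespace SpinCyclic

variable {m d : ℕ} [NeZero m] {S : Set (Arrow m d)}

/-! ### Double brackets -/

/-- The inclusion `b ↦ b ⊗ 1`. -/
def lft : PathAlg m d S →ₐ[ℂ] PathAlg m d S ⊗[ℂ] PathAlg m d S :=
  Algebra.TensorProduct.includeLeft

/-- The inclusion `b ↦ 1 ⊗ b`. -/
def rgt : PathAlg m d S →ₐ[ℂ] PathAlg m d S ⊗[ℂ] PathAlg m d S :=
  Algebra.TensorProduct.includeRight

/-- The flip `p ⊗ q ↦ q ⊗ p` of `A ⊗ A`. -/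
def flip : PathAlg m d S ⊗[ℂ] PathAlg m d S →ₐ[ℂ] PathAlg m d S ⊗[ℂ] PathAlg m d S :=
  (Algebra.TensorProduct.comm ℂ (PathAlg m d S) (PathAlg m d S)).toAlgHom

lemma lft_apply (b : PathAlg m d S) : lft b = b ⊗ₜ 1 := rfl

lemma rgt_apply (b : PathAlg m d S) : rgt b = 1 ⊗ₜ b := rfl

lemma flip_tmul (p q : PathAlg m d S) : flip (p ⊗ₜ q) = q ⊗ₜ p := rfl

lemma flip_lft (b : PathAlg m d S) : flip (lft b) = rgt b := rfl

lemma flip_rgt (b : PathAlg m d S) : flip (rgt b) = lft b := rfl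

lemma rgt_mul_lft (b c : PathAlg m d S) : rgt b * lft c = lft c * rgt b := by
  simp [lft_apply, rgt_apply]

lemma rgt_mul_lft_assoc (b c : PathAlg m d S) (t : PathAlg m d S ⊗[ℂ] PathAlg m d S) :
    rgt b * (lft c * t) = lft c * (rgt b * t) := by
  rw [← mul_assoc, rgt_mul_lft, mul_assoc]

/-- `δ` is a double derivation, that is a derivation for the outer bimodule structure. -/
def IsDoubleDer (δ : PathAlg m d S →ₗ[ℂ] PathAlg m d S ⊗[ℂ] PathAlg m d S) : Prop :=
  ∀ b c, δ (b * c) = lft b * δ c + δ b * rgt c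

/-- A double bracket: a skew-symmetric bilinear map which is a derivation in its first argument for
the inner bimodule structure, `{{bc, f}} = b ∗ {{c, f}} + {{b, f}} ∗ c`. -/
structure IsDoubleBracket
    (B : PathAlg m d S → PathAlg m d S → PathAlg m d S ⊗[ℂ] PathAlg m d S) : Prop where
  add_left : ∀ b c f, B (b + c) f = B b f + B c f
  smul_left : ∀ (r : ℂ) b f, B (r • b) f = r • B b f
  mul_left : ∀ b c f, B (b * c) f = rgt b * B c f + B b f * lft c
  skew : ∀ b c, B b c = -flip (B c b)

namespace IsDoubleBracket

variable {B C : PathAlg m d S → PathAlg m d S → PathAlg m d S ⊗[ℂ] PathAlg m d S}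

lemma add_right (h : IsDoubleBracket B) (f b c : PathAlg m d S) :
    B f (b + c) = B f b + B f c := by
  rw [h.skew, h.add_left, map_add, h.skew f b, h.skew f c]; abel

lemma smul_right (h : IsDoubleBracket B) (r : ℂ) (f b : PathAlg m d S) :
    B f (r • b) = r • B f b := by
  rw [h.skew, h.smul_left, map_smul, h.skew f b, smul_neg]

lemma mul_right (h : IsDoubleBracket B) (f b c : PathAlg m d S) :
    B f (b * c) = lft b * B f c + B f b * rgt c := by
  rw [h.skew, h.mul_left, map_add, map_mul, map_mul, flip_lft, flip_rgt, h.skew f b, h.skew f c]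
  simp only [mul_neg, neg_mul]; abel

lemma zero_left (h : IsDoubleBracket B) (f : PathAlg m d S) : B 0 f = 0 := by
  simpa using h.smul_left 0 0 f

lemma sum_left (h : IsDoubleBracket B) {ι : Type} (T : Finset ι) (b : ι → PathAlg m d S)
    (f : PathAlg m d S) : B (∑ i ∈ T, b i) f = ∑ i ∈ T, B (b i) f :=
  map_sum (⟨⟨fun b => B b f, h.zero_left f⟩, fun b c => h.add_left b c f⟩ :
    PathAlg m d S →+ PathAlg m d S ⊗[ℂ] PathAlg m d S) b T

protected lemma zero : IsDoubleBracket
    (fun _ _ => 0 : PathAlg m d S → PathAlg m d S → PathAlg m d S ⊗[ℂ] PathAlg m d S) where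
  add_left _ _ _ := by simp
  smul_left _ _ _ := by simp
  mul_left _ _ _ := by simp
  skew _ _ := by simp

protected lemma add (hB : IsDoubleBracket B) (hC : IsDoubleBracket C) :
    IsDoubleBracket (fun b c => B b c + C b c) where
  add_left b c f := by rw [hB.add_left, hC.add_left]; abel
  smul_left r b f := by rw [hB.smul_left, hC.smul_left, smul_add]
  mul_left b c f := by rw [hB.mul_left, hC.mul_left, mul_add, add_mul]; abel
  skew b c := by rw [hB.skew b c, hC.skew b c, map_add]; abel

protected lemma smul (r : ℂ) (hB : IsDoubleBracket B) :
    IsDoubleBracket (fun b c => r • B b c) where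
  add_left b c f := by rw [hB.add_left, smul_add]
  smul_left s b f := by rw [hB.smul_left, smul_comm]
  mul_left b c f := by rw [hB.mul_left, smul_add, mul_smul_comm, smul_mul_assoc]
  skew b c := by rw [hB.skew b c, map_smul, smul_neg]

protected lemma neg (hB : IsDoubleBracket B) : IsDoubleBracket (fun b c => -B b c) := by
  simpa using hB.smul (-1)

protected lemma sum {ι : Type} (T : Finset ι)
    (D : ι → PathAlg m d S → PathAlg m d S → PathAlg m d S ⊗[ℂ] PathAlg m d S)
    (h : ∀ i, IsDoubleBracket (D i)) : IsDoubleBracket (fun b c => ∑ i ∈ T, D i b c) := by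
  classical
  induction T using Finset.induction_on with
  | empty => simpa using IsDoubleBracket.zero
  | insert i T hi ih => simpa only [Finset.sum_insert hi] using (h i).add ih

end IsDoubleBracket

section Mix

variable (b : PathAlg m d S) (p p' q q' : PathAlg m d S ⊗[ℂ] PathAlg m d S)

lemma mix_add_left : mix (p + p') q = mix p q + mix p' q := by simp [mix]

lemma mix_add_right : mix p (q + q') = mix p q + mix p q' := by simp [mix]

lemma mix_zero_left : mix 0 q = 0 := by simp [mix]

lemma mix_zero_right : mix p 0 = 0 := by simp [mix]

lemma mix_neg_left : mix (-p) q = -mix p q := by simp [mix]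

lemma mix_neg_right : mix p (-q) = -mix p q := by simp [mix]

lemma mix_smul_left (r : ℂ) : mix (r • p) q = r • mix p q := by simp [mix]

lemma mix_lft_mul : mix (lft b * p) q = rgt b * mix p q := by
  induction p with
  | zero => simp [mix_zero_left]
  | add p p' hp hp' => simp only [mul_add, mix_add_left, hp, hp']
  | tmul p₁ p₂ =>
    induction q with
    | zero => simp [mix_zero_right]
    | add q q' hq hq' => simp only [mul_add, mix_add_right, hq, hq']
    | tmul q₁ q₂ => simp [lft_apply, rgt_apply, mix_tmul, mul_assoc]

lemma mix_mul_rgt : mix (p * rgt b) q = mix p q * lft b := by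
  induction p with
  | zero => simp [mix_zero_left]
  | add p p' hp hp' => simp only [add_mul, mix_add_left, hp, hp']
  | tmul p₁ p₂ =>
    induction q with
    | zero => simp [mix_zero_right]
    | add q q' hq hq' => simp only [add_mul, mix_add_right, hq, hq']
    | tmul q₁ q₂ => simp [lft_apply, rgt_apply, mix_tmul, mul_assoc]

lemma flip_mix : flip (mix p q) = mix q p := by
  induction p with
  | zero => simp [mix_zero_left, mix_zero_right]
  | add p p' hp hp' => simp only [mix_add_left, mix_add_right, map_add, hp, hp']
  | tmul p₁ p₂ =>
    induction q with
    | zero => simp [mix_zero_left, mix_zero_right]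
    | add q q' hq hq' => simp only [mix_add_left, mix_add_right, map_add, hq, hq']
    | tmul q₁ q₂ => simp [mix_tmul, flip_tmul]

end Mix

lemma isDoubleBracket_biBracket
    {δ₁ δ₂ : PathAlg m d S →ₗ[ℂ] PathAlg m d S ⊗[ℂ] PathAlg m d S}
    (h₁ : IsDoubleDer δ₁) (h₂ : IsDoubleDer δ₂) : IsDoubleBracket (biBracket δ₁ δ₂) where
  add_left b c f := by simp only [biBracket, map_add, mix_add_left]; abel
  smul_left r b f := by simp only [biBracket, map_smul, mix_smul_left, smul_sub]
  mul_left b c f := by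
    simp only [biBracket, h₁ b c, h₂ b c, mix_add_left, mix_lft_mul, mix_mul_rgt, mul_sub, sub_mul]
    abel
  skew b c := by simp only [biBracket, map_sub, flip_mix]; abel

lemma isDoubleDer_partialD (a : Arrow m d) :
    IsDoubleDer (partialD a : PathAlg m d S →ₗ[ℂ] _) := partialD_mul a

lemma inner_lft_mul (b c f : PathAlg m d S) (t : PathAlg m d S ⊗[ℂ] PathAlg m d S) :
    inner b c (lft f * t) = lft f * inner b c t := by
  induction t with
  | zero => simp
  | add t t' ht ht' => simp only [mul_add, map_add, ht, ht']
  | tmul t₁ t₂ => simp [lft_apply, inner_tmul, mul_assoc]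

lemma inner_mul_rgt (b c f : PathAlg m d S) (t : PathAlg m d S ⊗[ℂ] PathAlg m d S) :
    inner b c (t * rgt f) = inner b c t * rgt f := by
  induction t with
  | zero => simp
  | add t t' ht ht' => simp only [add_mul, map_add, ht, ht']
  | tmul t₁ t₂ => simp [rgt_apply, inner_tmul, mul_assoc]

lemma IsDoubleDer.bimod {δ : PathAlg m d S →ₗ[ℂ] PathAlg m d S ⊗[ℂ] PathAlg m d S}
    (h : IsDoubleDer δ) (b c : PathAlg m d S) : IsDoubleDer (bimod b δ c) := fun f g => by
  change inner b c (δ (f * g)) = lft f * inner b c (δ g) + inner b c (δ f) * rgt g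
  rw [h, map_add, inner_lft_mul, inner_mul_rgt]

lemma isDoubleDer_eulerD (a : Arrow m d) :
    IsDoubleDer (eulerD a : PathAlg m d S →ₗ[ℂ] _) := fun f g => by
  simp only [eulerD, LinearMap.sub_apply, (isDoubleDer_partialD a.star).bimod 1 (arr a.star) f g,
    (isDoubleDer_partialD a).bimod (arr a) 1 f g, mul_sub, sub_mul]
  abel

open scoped Classical in
lemma isDoubleBracket_doubleBracket :
    IsDoubleBracket (doubleBracket : PathAlg m d S → PathAlg m d S → _) := by
  have h₁ := (IsDoubleBracket.sum Finset.univ _ fun a : Arrow m d =>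
    (isDoubleBracket_biBracket (S := S) ((isDoubleDer_partialD a).bimod (1 + arr a.star * arr a) 1)
      (isDoubleDer_partialD a.star)).smul a.sign).smul (1 / 2)
  have h₂ := (IsDoubleBracket.sum Finset.univ _ fun a : Arrow m d =>
    IsDoubleBracket.sum Finset.univ
      (fun (a' : Arrow m d) b c => if a.tail = a'.tail ∧ a.lt a' then
        biBracket (eulerD (S := S) a) (eulerD a') b c else 0) fun a' => by
        split_ifs
        · exact isDoubleBracket_biBracket (isDoubleDer_eulerD a) (isDoubleDer_eulerD a')
        · exact IsDoubleBracket.zero).smul (1 / 2)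
  have h := h₁.add h₂.neg
  simp only [← sub_eq_add_neg] at h
  exact h

/-! ### The brackets of `x` and `y` -/

/-- The element `x = ∑ x_s`. -/
def xSum : PathAlg m d S := ∑ s : ZMod m, arr (.x s)

/-- The element `y = ∑ y_s`. -/
def ySum : PathAlg m d S := ∑ s : ZMod m, arr (.y s)

/-- The idempotent `∑ e_s` of the vertices `s ∈ I`. -/
def idem : PathAlg m d S := ∑ s : ZMod m, e (some s)

/-- `F_k = ∑ e_{s+k} ⊗ e_s`. The idempotents that a double bracket inserts are collected in the
elements `F_k` of the ring `A ⊗ A`. -/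
def F (k : ZMod m) : PathAlg m d S ⊗[ℂ] PathAlg m d S :=
  ∑ s : ZMod m, e (some (s + k)) ⊗ₜ e (some s)

lemma e_mul_e (r s : ZMod m) :
    (e (some r) * e (some s) : PathAlg m d S) = if r = s then e (some s) else 0 := by
  split_ifs with h
  · rw [h, e_mul_self]
  · exact e_mul_of_ne fun h' => h (Option.some.inj h')

lemma e_mul_sum (f : ZMod m → PathAlg m d S) (k : ZMod m)
    (h : ∀ s, e (some (s + k)) * f s = f s) (s : ZMod m) :
    e (some (s + k)) * ∑ r, f r = f s := by
  rw [Finset.mul_sum, Finset.sum_eq_single s]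
  · exact h s
  · intro r _ hr
    rw [← h r, ← mul_assoc, e_mul_e, if_neg fun h' => hr (add_right_cancel h').symm, zero_mul]
  · simp

lemma sum_mul_e (f : ZMod m → PathAlg m d S) (k : ZMod m)
    (h : ∀ s, f s * e (some (s + k)) = f s) (s : ZMod m) :
    (∑ r, f r) * e (some (s + k)) = f s := by
  rw [Finset.sum_mul, Finset.sum_eq_single s]
  · exact h s
  · intro r _ hr
    rw [← h r, mul_assoc, e_mul_e, if_neg fun h' => hr (add_right_cancel h'), mul_zero]
  · simp

lemma e_mul_x (s : ZMod m) : (e (some s) * arr (.x s) : PathAlg m d S) = arr (.x s) :=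
  e_tail_mul (.x s)

lemma x_mul_e (s : ZMod m) : (arr (.x s) * e (some (s + 1)) : PathAlg m d S) = arr (.x s) :=
  mul_e_head (.x s)

lemma e_mul_y (s : ZMod m) : (e (some (s + 1)) * arr (.y s) : PathAlg m d S) = arr (.y s) :=
  e_tail_mul (.y s)

lemma y_mul_e (s : ZMod m) : (arr (.y s) * e (some s) : PathAlg m d S) = arr (.y s) :=
  mul_e_head (.y s)

lemma e_mul_xSum (s : ZMod m) : (e (some s) * xSum : PathAlg m d S) = arr (.x s) := by
  simpa [xSum] using e_mul_sum (S := S) (fun s => arr (.x s)) 0 (by simpa using e_mul_x) s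

lemma xSum_mul_e (s : ZMod m) : (xSum * e (some (s + 1)) : PathAlg m d S) = arr (.x s) :=
  sum_mul_e _ 1 x_mul_e s

lemma e_mul_ySum (s : ZMod m) : (e (some (s + 1)) * ySum : PathAlg m d S) = arr (.y s) :=
  e_mul_sum _ 1 e_mul_y s

lemma ySum_mul_e (s : ZMod m) : (ySum * e (some s) : PathAlg m d S) = arr (.y s) := by
  simpa [ySum] using sum_mul_e (S := S) (fun s => arr (.y s)) 0 (by simpa using y_mul_e) s

lemma x_mul_xSum (s : ZMod m) :
    (arr (.x s) * xSum : PathAlg m d S) = arr (.x s) * arr (.x (s + 1)) := by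
  rw [← x_mul_e, mul_assoc, e_mul_xSum, x_mul_e]

lemma y_mul_ySum (s : ZMod m) :
    (arr (.y (s + 1)) * ySum : PathAlg m d S) = arr (.y (s + 1)) * arr (.y s) := by
  rw [← y_mul_e, mul_assoc, e_mul_ySum, y_mul_e]

section Values

variable (s : ZMod m)

lemma partialD_x_xSum : partialD (.x s) (xSum : PathAlg m d S) =
    e (some s) ⊗ₜ e (some (s + 1)) := by
  simp [xSum, partialD_arr, Arrow.tail, Arrow.head]

lemma partialD_y_xSum : partialD (.y s) (xSum : PathAlg m d S) = 0 := by
  simp [xSum, partialD_arr]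

lemma partialD_x_ySum : partialD (.x s) (ySum : PathAlg m d S) = 0 := by
  simp [ySum, partialD_arr]

lemma partialD_y_ySum : partialD (.y s) (ySum : PathAlg m d S) =
    e (some (s + 1)) ⊗ₜ e (some s) := by
  simp [ySum, partialD_arr, Arrow.tail, Arrow.head]

lemma eulerD_x_xSum : eulerD (.x s) (xSum : PathAlg m d S) = -(e (some s) ⊗ₜ arr (.x s)) := by
  simp [eulerD, bimod, Arrow.star, partialD_x_xSum, partialD_y_xSum, inner_tmul, x_mul_e]

lemma eulerD_x_ySum : eulerD (.x s) (ySum : PathAlg m d S) = arr (.y s) ⊗ₜ e (some s) := by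
  simp [eulerD, bimod, Arrow.star, partialD_x_ySum, partialD_y_ySum, inner_tmul, e_mul_y]

lemma eulerD_y_xSum : eulerD (.y s) (xSum : PathAlg m d S) = arr (.x s) ⊗ₜ e (some (s + 1)) := by
  simp [eulerD, bimod, Arrow.star, partialD_x_xSum, partialD_y_xSum, inner_tmul, e_mul_x]

lemma eulerD_y_ySum : eulerD (.y s) (ySum : PathAlg m d S) =
    -(e (some (s + 1)) ⊗ₜ arr (.y s)) := by
  simp [eulerD, bimod, Arrow.star, partialD_x_ySum, partialD_y_ySum, inner_tmul, y_mul_e]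

end Values

lemma sum_arrow {M : Type*} [AddCommMonoid M] (f : Arrow m d → M) :
    ∑ a, f a = (∑ s, f (.x s) + ∑ s, f (.y s)) + (∑ α, f (.v α) + ∑ α, f (.w α)) := by
  rw [← Equiv.sum_comp Arrow.equivSum.symm f, Fintype.sum_sum_type, Fintype.sum_sum_type,
    Fintype.sum_sum_type]
  rfl

/-- `b` is killed by all `∂/∂v_α` and `∂/∂w_α`. -/
def IsCyclic (b : PathAlg m d S) : Prop :=
  ∀ α : Fin d, partialD (.v α) b = 0 ∧ partialD (.w α) b = 0

lemma isCyclic_xSum : IsCyclic (xSum : PathAlg m d S) := fun α => by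
  simp [xSum, partialD_arr]

lemma isCyclic_ySum : IsCyclic (ySum : PathAlg m d S) := fun α => by
  simp [ySum, partialD_arr]

/-- On elements which do not involve the `v_α` and `w_α` the double bracket is the one of the
doubled cyclic quiver. -/
lemma doubleBracket_of_isCyclic {b c : PathAlg m d S} (hb : IsCyclic b) (hc : IsCyclic c) :
    doubleBracket b c = (1 / 2 : ℂ) • ∑ s : ZMod m,
      (biBracket (bimod (1 + arr (.y s) * arr (.x s)) (partialD (.x s)) 1) (partialD (.y s)) b c
      - biBracket (bimod (1 + arr (.x s) * arr (.y s)) (partialD (.y s)) 1) (partialD (.x s)) b c)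
      - (1 / 2 : ℂ) • ∑ s : ZMod m, biBracket (eulerD (.x (s + 1))) (eulerD (.y s)) b c := by
  have hv {b : PathAlg m d S} (hb : IsCyclic b) (α) : eulerD (.v α) b = 0 := by
    simp [eulerD, bimod, Arrow.star, hb α]
  have hw {b : PathAlg m d S} (hb : IsCyclic b) (α) : eulerD (.w α) b = 0 := by
    simp [eulerD, bimod, Arrow.star, hb α]
  have hv' (α : Fin d) (a) : biBracket (eulerD (.v α)) a b c = 0 := by
    simp [biBracket, hv hb, hv hc, mix_zero_left, mix_zero_right]
  have hw' (α : Fin d) (a) : biBracket (eulerD (.w α)) a b c = 0 := by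
    simp [biBracket, hw hb, hw hc, mix_zero_left, mix_zero_right]
  have hw'' (α : Fin d) (a) : biBracket a (eulerD (.w α)) b c = 0 := by
    simp [biBracket, hw hb, hw hc, mix_zero_left, mix_zero_right]
  unfold doubleBracket
  congr 2
  · rw [sum_arrow, Finset.sum_sub_distrib]
    simp [Arrow.sign, Arrow.star, biBracket, bimod, hb _, hc _, mix_zero_right]
    abel
  · rw [sum_arrow]
    simp only [sum_arrow, Arrow.lt, Arrow.tail, and_false, and_true, if_false,
      Finset.sum_const_zero, add_zero, zero_add, hv', hw', hw'', ite_self, Option.some.injEq]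
    rw [Finset.sum_comm]
    refine Finset.sum_congr rfl fun s _ => ?_
    simp

lemma lft_mul_F_mul (b c : PathAlg m d S) (k : ZMod m) : lft b * F k * lft c =
    ∑ s : ZMod m, (b * e (some (s + k)) * c) ⊗ₜ e (some s) := by
  simp [lft_apply, F, Finset.mul_sum, Finset.sum_mul]

lemma rgt_mul_F_mul (b c : PathAlg m d S) (k : ZMod m) : rgt b * F k * rgt c =
    ∑ s : ZMod m, e (some (s + k)) ⊗ₜ (b * e (some s) * c) := by
  simp [rgt_apply, F, Finset.mul_sum, Finset.sum_mul]

lemma sum_shift {M : Type*} [AddCommMonoid M] (f : ZMod m → M) : ∑ s, f (s + 1) = ∑ s, f s :=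
  Equiv.sum_comp (Equiv.addRight (1 : ZMod m)) f

lemma doubleBracket_xSum_xSum : doubleBracket (xSum : PathAlg m d S) xSum =
    (1 / 2 : ℂ) • (lft xSum * F 0 * lft xSum - rgt xSum * F 0 * rgt xSum) := by
  rw [doubleBracket_of_isCyclic isCyclic_xSum isCyclic_xSum]
  simp only [biBracket, bimod, LinearMap.comp_apply, partialD_x_xSum, partialD_y_xSum,
    eulerD_x_xSum, eulerD_y_xSum, map_zero, mix_zero_left, mix_zero_right, sub_zero, mix_neg_left,
    mix_neg_right, mix_tmul, Finset.sum_const_zero, smul_zero, zero_sub, lft_mul_F_mul,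
    rgt_mul_F_mul, ← smul_neg]
  congr 1
  rw [← Finset.sum_sub_distrib, ← Finset.sum_neg_distrib, ← sum_shift fun s => _ - _]
  refine Finset.sum_congr rfl fun s _ => ?_
  simp only [add_zero, xSum_mul_e, x_mul_xSum, e_mul_self]
  abel

lemma doubleBracket_ySum_ySum : doubleBracket (ySum : PathAlg m d S) ySum =
    -((1 / 2 : ℂ) • (lft ySum * F 0 * lft ySum - rgt ySum * F 0 * rgt ySum)) := by
  rw [doubleBracket_of_isCyclic isCyclic_ySum isCyclic_ySum]
  simp only [biBracket, bimod, LinearMap.comp_apply, partialD_x_ySum, partialD_y_ySum,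
    eulerD_x_ySum, eulerD_y_ySum, map_zero, mix_zero_left, mix_zero_right, sub_zero, mix_neg_left,
    mix_neg_right, mix_tmul, Finset.sum_const_zero, smul_zero, zero_sub, lft_mul_F_mul,
    rgt_mul_F_mul]
  congr 2
  rw [← Finset.sum_sub_distrib]
  conv_rhs => rw [← sum_shift]
  refine Finset.sum_congr rfl fun s _ => ?_
  simp only [add_zero, ySum_mul_e, y_mul_ySum, e_mul_self]
  abel

lemma doubleBracket_xSum_ySum : doubleBracket (xSum : PathAlg m d S) ySum =
    F 1 + (1 / 2 : ℂ) • (lft ySum * lft xSum * F 1 + F 1 * rgt xSum * rgt ySum +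
      lft ySum * rgt xSum * F 0 - F 0 * lft xSum * rgt ySum) := by
  have h₁ : (lft ySum * lft xSum * F 1 : PathAlg m d S ⊗[ℂ] PathAlg m d S) =
      ∑ s : ZMod m, (arr (.y s) * arr (.x s)) ⊗ₜ e (some s) := by
    simp only [F, Finset.mul_sum, lft_apply, Algebra.TensorProduct.tmul_mul_tmul, one_mul,
      mul_assoc, xSum_mul_e]
    refine Finset.sum_congr rfl fun s _ => ?_
    rw [← e_mul_x, ← mul_assoc, ySum_mul_e, ← mul_assoc, y_mul_e]
  have h₂ : (F 1 * rgt xSum * rgt ySum : PathAlg m d S ⊗[ℂ] PathAlg m d S) =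
      ∑ s : ZMod m, e (some (s + 1)) ⊗ₜ (arr (.x s) * arr (.y s)) := by
    simp only [F, Finset.sum_mul, rgt_apply, Algebra.TensorProduct.tmul_mul_tmul, mul_one,
      e_mul_xSum]
    refine Finset.sum_congr rfl fun s _ => ?_
    rw [← e_mul_ySum, ← mul_assoc, x_mul_e]
  have h₃ : (lft ySum * rgt xSum * F 0 : PathAlg m d S ⊗[ℂ] PathAlg m d S) =
      ∑ s : ZMod m, arr (.y (s + 1)) ⊗ₜ arr (.x s) := by
    simp only [F, Finset.mul_sum, lft_apply, rgt_apply, Algebra.TensorProduct.tmul_mul_tmul,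
      one_mul, mul_one, add_zero]
    rw [← sum_shift]
    simp only [ySum_mul_e, xSum_mul_e]
  have h₄ : (F 0 * lft xSum * rgt ySum : PathAlg m d S ⊗[ℂ] PathAlg m d S) =
      ∑ s : ZMod m, arr (.x (s + 1)) ⊗ₜ arr (.y s) := by
    simp only [F, Finset.sum_mul, lft_apply, rgt_apply, Algebra.TensorProduct.tmul_mul_tmul,
      mul_one, add_zero]
    rw [← sum_shift]
    simp only [e_mul_ySum, e_mul_xSum]
  rw [doubleBracket_of_isCyclic isCyclic_xSum isCyclic_ySum, h₁, h₂, h₃, h₄]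
  have h₅ : (F 1 : PathAlg m d S ⊗[ℂ] PathAlg m d S) = (1 / 2 : ℂ) • ∑ s : ZMod m,
      ((e (some (s + 1)) ⊗ₜ e (some s) : PathAlg m d S ⊗[ℂ] PathAlg m d S) +
        e (some (s + 1)) ⊗ₜ e (some s)) := by
    rw [Finset.sum_add_distrib, ← F]; module
  rw [h₅, ← smul_sub, ← smul_add]
  congr 1
  simp only [← Finset.sum_sub_distrib, ← Finset.sum_add_distrib]
  refine Finset.sum_congr rfl fun s _ => ?_
  simp only [biBracket, bimod, LinearMap.comp_apply, partialD_x_ySum, partialD_y_ySum,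
    partialD_x_xSum, partialD_y_xSum, eulerD_x_ySum, eulerD_y_ySum, eulerD_x_xSum, eulerD_y_xSum,
    map_zero, mix_zero_right, sub_zero, zero_sub, inner_tmul, mul_one, mix_neg_left, mix_neg_right,
    mix_add_left, mix_add_right, mix_tmul, add_mul, one_mul, mul_assoc, e_mul_self, x_mul_e,
    y_mul_e, TensorProduct.tmul_add]
  simp only [← mul_assoc, e_mul_x, e_mul_y]
  abel

/-! ### Homogeneous elements -/

/-- `f` is homogeneous of degree `k ∈ ℤ/m`: it leads from `s + k` to `s` for each `s ∈ I`. -/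
def IsHomog (k : ZMod m) (f : PathAlg m d S) : Prop :=
  ∀ s : ZMod m, f * e (some s) = e (some (s + k)) * f

namespace IsHomog

variable {k l : ZMod m} {f g : PathAlg m d S}

protected lemma one : IsHomog 0 (1 : PathAlg m d S) := fun s => by simp

protected lemma mul (hf : IsHomog k f) (hg : IsHomog l g) : IsHomog (l + k) (f * g) := fun s => by
  rw [mul_assoc, hg s, ← mul_assoc, hf, mul_assoc, add_assoc]

protected lemma add (hf : IsHomog k f) (hg : IsHomog k g) : IsHomog k (f + g) := fun s => by
  rw [add_mul, mul_add, hf s, hg s]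

protected lemma smul (hf : IsHomog k f) (r : ℂ) : IsHomog k (r • f) := fun s => by
  rw [smul_mul_assoc, mul_smul_comm, hf s]

protected lemma pow (hf : IsHomog k f) (n : ℕ) : IsHomog ((n : ZMod m) * k) (f ^ n) := by
  induction n with
  | zero => simpa using IsHomog.one
  | succ n ih =>
    rw [pow_succ, Nat.cast_succ, add_mul, one_mul, add_comm]
    exact ih.mul hf

protected lemma sum {T : Finset (ZMod m)} {f : ZMod m → PathAlg m d S}
    (h : ∀ s, IsHomog k (f s)) : IsHomog k (∑ s ∈ T, f s) := fun s => by
  rw [Finset.sum_mul, Finset.mul_sum]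
  exact Finset.sum_congr rfl fun r _ => h r s

lemma lft_mul_F (hf : IsHomog k f) (j : ZMod m) : lft f * F j = F (j + k) * lft f := by
  simp only [F, lft_apply, Finset.mul_sum, Finset.sum_mul, Algebra.TensorProduct.tmul_mul_tmul, hf
    _, one_mul, mul_one, add_assoc]

lemma rgt_mul_F (hf : IsHomog k f) (j : ZMod m) : rgt f * F j = F (j - k) * rgt f := by
  simp only [F, rgt_apply, Finset.mul_sum, Finset.sum_mul, Algebra.TensorProduct.tmul_mul_tmul, hf
    _, one_mul, mul_one]
  conv_rhs => rw [← Equiv.sum_comp (Equiv.addRight k)]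
  refine Finset.sum_congr rfl fun s _ => ?_
  simp only [Equiv.coe_addRight, add_add_sub_cancel]

/-- The rules for moving a homogeneous element past the `F_k`, in a form suited to `simp`. -/
lemma comm_F (hf : IsHomog k f) :
    (∀ j, lft f * F j = F (j + k) * lft f) ∧ (∀ j, rgt f * F j = F (j + -k) * rgt f) ∧
    (∀ j t, lft f * (F j * t) = F (j + k) * (lft f * t)) ∧
    ∀ j t, rgt f * (F j * t) = F (j + -k) * (rgt f * t) := by
  refine ⟨hf.lft_mul_F, fun j => ?_, fun j t => ?_, fun j t => ?_⟩
  · rw [hf.rgt_mul_F, sub_eq_add_neg]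
  · rw [← mul_assoc, hf.lft_mul_F, mul_assoc]
  · rw [← mul_assoc, hf.rgt_mul_F, mul_assoc, sub_eq_add_neg]

end IsHomog

lemma isHomog_of_corner {r : ZMod m} {f : PathAlg m d S} (h₁ : e (some r) * f = f)
    (h₂ : f * e (some r) = f) : IsHomog 0 f := fun s => by
  rw [add_zero, ← h₂, mul_assoc, e_mul_e, h₂, ← h₁, ← mul_assoc, e_mul_e]
  obtain rfl | h := eq_or_ne r s
  · simp only [if_true, h₁, h₂]
  · simp [h, h.symm]

lemma isHomog_idem : IsHomog 0 (idem : PathAlg m d S) :=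
  IsHomog.sum fun _ => isHomog_of_corner (e_mul_self _) (e_mul_self _)

lemma isHomog_xSum : IsHomog (-1) (xSum : PathAlg m d S) := fun s => by
  rw [e_mul_xSum]
  simpa using xSum_mul_e (S := S) (s + -1)

lemma isHomog_ySum : IsHomog 1 (ySum : PathAlg m d S) := fun s => by
  rw [e_mul_ySum, ySum_mul_e]

lemma idem_mul_e (s : ZMod m) : (idem * e (some s) : PathAlg m d S) = e (some s) := by
  simp [idem, Finset.sum_mul, e_mul_e]

lemma e_mul_idem (s : ZMod m) : (e (some s) * idem : PathAlg m d S) = e (some s) := by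
  simp [idem, Finset.mul_sum, e_mul_e]

lemma idem_mul_idem : (idem * idem : PathAlg m d S) = idem := by
  nth_rw 1 [idem]
  simp only [Finset.sum_mul, e_mul_idem]
  rfl

lemma idem_mul_xSum : (idem * xSum : PathAlg m d S) = xSum := by
  simp only [idem, Finset.sum_mul, e_mul_xSum]
  rfl

lemma idem_mul_ySum : (idem * ySum : PathAlg m d S) = ySum := by
  conv_lhs => rw [idem, ← sum_shift, Finset.sum_mul]
  simp only [e_mul_ySum]
  rfl

lemma ySum_mul_idem : (ySum * idem : PathAlg m d S) = ySum := by
  simp only [idem, Finset.mul_sum, ySum_mul_e]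
  rfl

lemma F_mul_lft_idem (k : ZMod m) : F k * lft idem = (F k : PathAlg m d S ⊗[ℂ] PathAlg m d S) := by
  simp [F, Finset.sum_mul, lft_apply, e_mul_idem]

lemma F_mul_rgt_idem (k : ZMod m) : F k * rgt idem = (F k : PathAlg m d S ⊗[ℂ] PathAlg m d S) := by
  simp [F, Finset.sum_mul, rgt_apply, e_mul_idem]

/-- The rules for removing idempotents behind `F_k`, in a form suited to `simp`. -/
lemma F_mul_idem (k : ZMod m) : F k * lft idem = (F k : PathAlg m d S ⊗[ℂ] PathAlg m d S) ∧
    F k * rgt idem = (F k : PathAlg m d S ⊗[ℂ] PathAlg m d S) ∧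
    (∀ t : PathAlg m d S ⊗[ℂ] PathAlg m d S, F k * (lft idem * t) = F k * t) ∧
    (∀ t : PathAlg m d S ⊗[ℂ] PathAlg m d S, F k * (rgt idem * t) = F k * t) ∧
    (∀ c : PathAlg m d S, F k * (lft c * rgt idem) = F k * lft c) ∧
    ∀ (c : PathAlg m d S) (t : PathAlg m d S ⊗[ℂ] PathAlg m d S),
      F k * (lft c * (rgt idem * t)) = F k * (lft c * t) := by
  refine ⟨F_mul_lft_idem k, F_mul_rgt_idem k, fun t => ?_, fun t => ?_, fun c => ?_,
    fun c t => ?_⟩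
  · rw [← mul_assoc, F_mul_lft_idem]
  · rw [← mul_assoc, F_mul_rgt_idem]
  · rw [← rgt_mul_lft, ← mul_assoc, F_mul_rgt_idem]
  · rw [← rgt_mul_lft_assoc, ← mul_assoc, F_mul_rgt_idem]

/-- The rules for removing idempotents behind `a`, in a form suited to `simp`. -/
lemma mul_idem_rules {a : PathAlg m d S} (h : a * idem = a) :
    (lft a * lft idem = (lft a : PathAlg m d S ⊗[ℂ] PathAlg m d S)) ∧
    (rgt a * rgt idem = (rgt a : PathAlg m d S ⊗[ℂ] PathAlg m d S)) ∧
    (∀ t : PathAlg m d S ⊗[ℂ] PathAlg m d S, lft a * (lft idem * t) = lft a * t) ∧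
    ∀ t : PathAlg m d S ⊗[ℂ] PathAlg m d S, rgt a * (rgt idem * t) = rgt a * t := by
  simp only [← mul_assoc, ← map_mul, h, implies_true, and_self]

lemma flip_F (k : ZMod m) : flip (F k) = (F (-k) : PathAlg m d S ⊗[ℂ] PathAlg m d S) := by
  simp only [F, map_sum, flip_tmul]
  rw [← Equiv.sum_comp (Equiv.addRight (-k))]
  simp

lemma doubleBracket_idem_left (c : PathAlg m d S) : doubleBracket idem c = 0 := by
  have h (s) : doubleBracket (e (some s)) c = 0 := by
    simp [doubleBracket, biBracket, bimod, eulerD, partialD_e, mix_zero_left]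
  simp [idem, isDoubleBracket_doubleBracket.sum_left, h]

lemma doubleBracket_ySum_xSum : doubleBracket (ySum : PathAlg m d S) xSum =
    -(F (-1) + (1 / 2 : ℂ) • (rgt ySum * rgt xSum * F (-1) + F (-1) * lft xSum * lft ySum +
      rgt ySum * lft xSum * F 0 - F 0 * rgt xSum * lft ySum)) := by
  rw [isDoubleBracket_doubleBracket.skew, doubleBracket_xSum_ySum]
  simp only [map_add, map_smul, map_sub, map_mul, flip_F, flip_lft, flip_rgt, neg_zero]

/-! ### The element `φ` -/

lemma sum_mul_sum_diag (f g : ZMod m → PathAlg m d S)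
    (hf : ∀ s, f s * e (some s) = f s) (hg : ∀ s, e (some s) * g s = g s) :
    (∑ s, f s) * ∑ s, g s = ∑ s, f s * g s := by
  rw [Finset.sum_mul]
  refine Finset.sum_congr rfl fun s _ => ?_
  have := e_mul_sum g 0 (by simpa using hg) s
  rw [add_zero] at this
  rw [← hf s, mul_assoc, this, hf]

/-- The local inverse of `∑ e_s + yx`. -/
def yxInv : PathAlg m d S := ∑ s : ZMod m, e (some s) * inv (.y (s - 1)) * e (some s)

lemma idem_add_xy : (idem + xSum * ySum : PathAlg m d S) =
    ∑ s : ZMod m, (e (some s) + arr (.x s) * arr (.y s)) := by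
  rw [Finset.sum_add_distrib, ← idem, xSum, Finset.sum_mul]
  congr 1
  refine Finset.sum_congr rfl fun s _ => ?_
  rw [← e_mul_ySum, ← mul_assoc, x_mul_e]

lemma idem_add_yx : (idem + ySum * xSum : PathAlg m d S) =
    ∑ s : ZMod m, (e (some s) + arr (.y (s - 1)) * arr (.x (s - 1))) := by
  rw [Finset.sum_add_distrib, ← idem, ySum, Finset.sum_mul,
    ← sum_shift fun s => arr (.y (s - 1)) * arr (.x (s - 1))]
  congr 1
  refine Finset.sum_congr rfl fun s _ => ?_
  rw [add_sub_cancel_right, ← e_mul_xSum, ← mul_assoc, y_mul_e]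

lemma corner_y (s : ZMod m) :
    ((e (some s) + arr (.y (s - 1)) * arr (.x (s - 1))) * e (some s) : PathAlg m d S) =
      e (some s) + arr (.y (s - 1)) * arr (.x (s - 1)) ∧
    (e (some s) * (e (some s) + arr (.y (s - 1)) * arr (.x (s - 1))) : PathAlg m d S) =
      e (some s) + arr (.y (s - 1)) * arr (.x (s - 1)) := by
  have h₁ := x_mul_e (S := S) (s - 1)
  have h₂ := e_mul_y (S := S) (s - 1)
  rw [sub_add_cancel] at h₁ h₂
  constructor
  · rw [add_mul, mul_assoc, h₁, e_mul_self]
  · rw [mul_add, ← mul_assoc, h₂, e_mul_self]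

lemma yxInv_mul : (yxInv * (idem + ySum * xSum) : PathAlg m d S) = idem := by
  rw [idem_add_yx]
  refine sum_mul_sum_corner _ _ (fun s => ?_) (fun s => (corner_y s).2) fun s => ?_
  · rw [mul_assoc, e_mul_self]
  · simpa [Arrow.tail, Arrow.star] using (local_inv (S := S) (.y (s - 1))).2

lemma mul_yxInv : ((idem + ySum * xSum) * yxInv : PathAlg m d S) = idem := by
  rw [idem_add_yx]
  refine sum_mul_sum_corner _ _ (fun s => (corner_y s).1) (fun s => ?_) fun s => ?_
  · rw [mul_assoc, ← mul_assoc (e _) (e _), e_mul_self]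
  · simpa [Arrow.tail, Arrow.star] using (local_inv (S := S) (.y (s - 1))).1

lemma phi_eq : (phi : PathAlg m d S) = (idem + xSum * ySum) * yxInv := by
  rw [idem_add_xy, phi, yxInv]
  refine (sum_mul_sum_diag _ _ (fun s => ?_) fun s => ?_).symm
  · rw [add_mul, mul_assoc, y_mul_e, e_mul_self]
  · rw [mul_assoc, ← mul_assoc (e _) (e _), e_mul_self]

lemma yxInv_mul_idem : (yxInv * idem : PathAlg m d S) = yxInv := by
  simp only [yxInv, Finset.sum_mul, mul_assoc, e_mul_idem]

lemma phi_mul_idem : (phi * idem : PathAlg m d S) = phi := by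
  rw [phi_eq, mul_assoc, yxInv_mul_idem]

lemma phi_mul_yx : (phi * (idem + ySum * xSum) : PathAlg m d S) = idem + xSum * ySum := by
  rw [phi_eq, mul_assoc, yxInv_mul, add_mul, idem_mul_idem, mul_assoc, ySum_mul_idem]

lemma isHomog_phi : IsHomog 0 (phi : PathAlg m d S) := by
  refine IsHomog.sum fun r => isHomog_of_corner (r := r) ?_ ?_
  · rw [← mul_assoc, mul_add, e_mul_self, ← mul_assoc (e _) (arr _), e_mul_x]
  · simp only [mul_assoc, e_mul_self]

lemma isHomog_phiInv : IsHomog 0 (phiInv : PathAlg m d S) := by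
  refine IsHomog.sum fun r => isHomog_of_corner (r := r) ?_ ?_
  · rw [← mul_assoc, (corner_y r).2]
  · simp only [mul_assoc, e_mul_self]

lemma phiInv_mul_idem : (phiInv * idem : PathAlg m d S) = phiInv := by
  simp only [phiInv, Finset.sum_mul, mul_assoc, e_mul_idem]

lemma idem_mul_phiInv : (idem * phiInv : PathAlg m d S) = phiInv := by
  simp only [phiInv, Finset.mul_sum]
  refine Finset.sum_congr rfl fun s _ => ?_
  rw [← (corner_y s).2]
  simp only [← mul_assoc, idem_mul_e]

/-! ### Moment maps -/

section Moment

variable {B : PathAlg m d S → PathAlg m d S → PathAlg m d S ⊗[ℂ] PathAlg m d S}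
  {g a b : PathAlg m d S}

/-- The moment map property of `g` at the element `a`:
`{{g, a}} = ½ (a G - G a)` for the outer bimodule structure, where
`G = (g ⊗ 1 + 1 ⊗ g) F_0`. For `g = ∑ g_s` with `g_s ∈ e_s A e_s` this sums up the usual formulas
`{{g_s, a}} = ½ (a e_s ⊗ g_s - e_s ⊗ g_s a + a g_s ⊗ e_s - g_s ⊗ e_s a)`. -/
def IsMomentAt (B : PathAlg m d S → PathAlg m d S → PathAlg m d S ⊗[ℂ] PathAlg m d S)
    (g a : PathAlg m d S) : Prop :=
  B g a = (1 / 2 : ℂ) • (lft a * ((lft g + rgt g) * F 0) - (lft g + rgt g) * F 0 * rgt a)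

namespace IsMomentAt

lemma add (hB : IsDoubleBracket B) (ha : IsMomentAt B g a) (hb : IsMomentAt B g b) :
    IsMomentAt B g (a + b) := by
  rw [IsMomentAt, hB.add_right, ha, hb, map_add, map_add]
  simp only [mul_add, add_mul]
  module

lemma mul (hB : IsDoubleBracket B) (ha : IsMomentAt B g a) (hb : IsMomentAt B g b) :
    IsMomentAt B g (a * b) := by
  rw [IsMomentAt, hB.mul_right, ha, hb, map_mul, map_mul]
  simp only [mul_smul_comm, smul_mul_assoc, mul_sub, sub_mul, mul_assoc]
  module

/-- The property passes from `a` to a local inverse `b` of `a`. -/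
lemma local_inverse (hB : IsDoubleBracket B) (ha : IsMomentAt B g a) (hi : IsMomentAt B g idem)
    (hba : b * a = idem) (hab : a * b = idem) (hb : b * idem = b) : IsMomentAt B g b := by
  -- The defect `δ` of the property at `b` satisfies `δ a = 0`, and `δ = δ a b`.
  set c := (lft g + rgt g) * F 0 with hc
  set δ := B g b - (1 / 2 : ℂ) • (lft b * c - c * rgt b) with hδ
  have h₁ : δ * rgt a = 0 := by
    have h := hB.mul_right g b a
    rw [hba, hi, ha, ← hc, ← hba, map_mul, map_mul] at h
    rw [hδ, sub_mul, eq_sub_of_add_eq' h.symm]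
    simp only [mul_smul_comm, smul_mul_assoc, mul_sub, sub_mul, mul_assoc]
    module
  have h₂ : δ * rgt idem = δ := by
    have h := hB.mul_right g b idem
    rw [hb, hi, ← hc] at h
    have h₃ : lft b * lft idem = (lft b : PathAlg m d S ⊗[ℂ] PathAlg m d S) := by
      rw [← map_mul, hb]
    have h₄ : c * rgt idem = c := by rw [hc, mul_assoc, F_mul_rgt_idem]
    have h₅ : rgt b * rgt idem = (rgt b : PathAlg m d S ⊗[ℂ] PathAlg m d S) := by
      rw [← map_mul, hb]
    rw [h₄, mul_smul_comm, mul_sub, ← mul_assoc (lft b), h₃, sub_self, smul_zero, zero_add] at h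
    rw [hδ, sub_mul, ← h, smul_mul_assoc, sub_mul, mul_assoc, h₄, mul_assoc, h₅]
  rw [← hab, map_mul, ← mul_assoc, h₁, zero_mul] at h₂
  exact sub_eq_zero.mp h₂.symm

end IsMomentAt

/-- If `g` has the moment map property for `B`, then its local inverse has it for `-B`. -/
lemma IsMomentAt.neg_inverse (hB : IsDoubleBracket B) (hi : B idem a = 0) (hg : IsMomentAt B g a)
    (hgh : IsHomog 0 g) (hb : IsHomog 0 b) (hgb : g * b = idem) (hbg : b * g = idem)
    (hib : idem * b = b) :
    IsMomentAt (fun f f' => -B f f') b a := by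
  have h := hB.mul_left g b a
  rw [hgb, hi, hg] at h
  have h₁ : B b a = rgt b * (rgt g * B b a) := by
    have h₂ := hB.mul_left idem b a
    rw [hib, hi, zero_mul, add_zero] at h₂
    rw [← mul_assoc, ← map_mul, hbg, ← h₂]
  rw [eq_neg_of_add_eq_zero_left h.symm] at h₁
  have e₁ (t : PathAlg m d S ⊗[ℂ] PathAlg m d S) : lft g * (lft b * t) = lft idem * t := by
    rw [← mul_assoc, ← map_mul, hgb]
  have e₂ : rgt b * rgt g = (rgt idem : PathAlg m d S ⊗[ℂ] PathAlg m d S) := by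
    rw [← map_mul, hbg]
  have e₃ (t : PathAlg m d S ⊗[ℂ] PathAlg m d S) : rgt b * (rgt g * t) = rgt idem * t := by
    rw [← mul_assoc, e₂]
  rw [IsMomentAt, h₁]
  simp only [mul_add, add_mul, mul_sub, sub_mul, mul_smul_comm, smul_mul_assoc, mul_neg, mul_assoc,
    rgt_mul_lft, rgt_mul_lft_assoc, hgh.comm_F, hb.comm_F, neg_zero, add_zero, e₁, e₂, e₃,
    F_mul_idem]
  module

end Moment

/-! ### The moment map property of `φ` -/

lemma doubleBracket_xy_xSum : doubleBracket (idem + xSum * ySum : PathAlg m d S) xSum =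
    (1 / 2 : ℂ) • (lft xSum * F 0 * (lft (xSum * ySum) - rgt (xSum * ySum)) -
      F 0 * (2 + lft (xSum * ySum) + rgt (xSum * ySum)) * rgt xSum) := by
  have hB := isDoubleBracket_doubleBracket (S := S)
  rw [hB.add_left, hB.mul_left, doubleBracket_idem_left, doubleBracket_xSum_xSum,
    doubleBracket_ySum_xSum]
  simp only [map_mul, mul_add, add_mul, mul_sub, sub_mul, mul_smul_comm, smul_mul_assoc, mul_assoc,
    mul_neg, rgt_mul_lft, rgt_mul_lft_assoc, isHomog_xSum.comm_F, isHomog_ySum.comm_F, zero_add,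
    neg_neg, neg_add_cancel, neg_add_cancel_right, mul_two]
  module

lemma doubleBracket_xy_ySum : doubleBracket (idem + xSum * ySum : PathAlg m d S) ySum =
    (1 / 2 : ℂ) • (lft ySum * F 0 * (2 + lft (xSum * ySum) + rgt (xSum * ySum)) -
      F 0 * (lft (xSum * ySum) - rgt (xSum * ySum)) * rgt ySum) := by
  have hB := isDoubleBracket_doubleBracket (S := S)
  rw [hB.add_left, hB.mul_left, doubleBracket_idem_left, doubleBracket_ySum_ySum,
    doubleBracket_xSum_ySum]
  simp only [map_mul, mul_add, add_mul, mul_sub, sub_mul, mul_smul_comm, smul_mul_assoc, mul_assoc,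
    mul_neg, rgt_mul_lft, rgt_mul_lft_assoc, isHomog_xSum.comm_F, isHomog_ySum.comm_F, zero_add,
    neg_neg, neg_add_cancel, add_neg_cancel, mul_two]
  module

lemma doubleBracket_yx_xSum : doubleBracket (idem + ySum * xSum : PathAlg m d S) xSum =
    (1 / 2 : ℂ) • (F 0 * (lft (ySum * xSum) - rgt (ySum * xSum)) * rgt xSum -
      lft xSum * F 0 * (2 + lft (ySum * xSum) + rgt (ySum * xSum))) := by
  have hB := isDoubleBracket_doubleBracket (S := S)
  rw [hB.add_left, hB.mul_left, doubleBracket_idem_left, doubleBracket_xSum_xSum,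
    doubleBracket_ySum_xSum]
  simp only [map_mul, mul_add, add_mul, mul_sub, sub_mul, mul_smul_comm, smul_mul_assoc, mul_assoc,
    neg_mul, rgt_mul_lft, rgt_mul_lft_assoc, isHomog_xSum.comm_F, isHomog_ySum.comm_F, zero_add,
    neg_neg, neg_add_cancel, add_neg_cancel, mul_two]
  module

lemma doubleBracket_yx_ySum : doubleBracket (idem + ySum * xSum : PathAlg m d S) ySum =
    (1 / 2 : ℂ) • (F 0 * (2 + lft (ySum * xSum) + rgt (ySum * xSum)) * rgt ySum -
      lft ySum * F 0 * (lft (ySum * xSum) - rgt (ySum * xSum))) := by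
  have hB := isDoubleBracket_doubleBracket (S := S)
  rw [hB.add_left, hB.mul_left, doubleBracket_idem_left, doubleBracket_ySum_ySum,
    doubleBracket_xSum_ySum]
  simp only [map_mul, mul_add, add_mul, mul_sub, sub_mul, mul_smul_comm, smul_mul_assoc, mul_assoc,
    neg_mul, rgt_mul_lft, rgt_mul_lft_assoc, isHomog_xSum.comm_F, isHomog_ySum.comm_F, zero_add,
    neg_neg, add_neg_cancel, add_neg_cancel_right, mul_two]
  module

/-- With `p = ∑ e_s + xy` and `r = ∑ e_s + yx` one has `φ r = p`, so `{{p, a}} - φ ∗ {{r, a}}` is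
`{{φ, a}} ∗ r`. As `r` is locally invertible, the moment map property of `φ` at `a` may be checked
after this multiplication. -/
lemma isMomentAt_phi_of_brackets {a : PathAlg m d S}
    (h : (doubleBracket (idem + xSum * ySum) a - rgt phi * doubleBracket (idem + ySum * xSum) a :
        PathAlg m d S ⊗[ℂ] PathAlg m d S) =
      (1 / 2 : ℂ) • (lft a * ((lft phi + rgt phi) * F 0) - (lft phi + rgt phi) * F 0 * rgt a) *
        lft (idem + ySum * xSum)) : IsMomentAt doubleBracket phi a := by
  have hB := isDoubleBracket_doubleBracket (S := S)
  have h₁ : doubleBracket phi a * lft idem = doubleBracket phi a := by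
    have := hB.mul_left phi idem a
    rwa [phi_mul_idem, doubleBracket_idem_left, mul_zero, zero_add, eq_comm] at this
  rw [← phi_mul_yx, hB.mul_left, add_sub_cancel_left] at h
  have h₂ := congrArg (· * lft yxInv) h
  simp only [mul_assoc, ← map_mul, mul_yxInv] at h₂
  rw [h₁] at h₂
  rw [IsMomentAt, h₂]
  simp only [mul_add, add_mul, sub_mul, smul_mul_assoc, mul_assoc, rgt_mul_lft, rgt_mul_lft_assoc,
    isHomog_phi.comm_F, F_mul_idem, add_zero, neg_zero, mul_idem_rules phi_mul_idem]

/-- On the right of `F_0`, the relation `φ (∑ e_s + yx) = ∑ e_s + xy` lets one eliminate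
`φ y x`, in both tensor factors. -/
lemma F_mul_phi_yx :
    (F 0 * (lft phi * lft (ySum * xSum)) : PathAlg m d S ⊗[ℂ] PathAlg m d S) =
      F 0 + F 0 * lft (xSum * ySum) - F 0 * lft phi ∧
    (F 0 * (rgt phi * rgt (ySum * xSum)) : PathAlg m d S ⊗[ℂ] PathAlg m d S) =
      F 0 + F 0 * rgt (xSum * ySum) - F 0 * rgt phi ∧
    (∀ t, (F 0 * (lft phi * (lft (ySum * xSum) * t)) : PathAlg m d S ⊗[ℂ] PathAlg m d S) =
      F 0 * t + F 0 * (lft (xSum * ySum) * t) - F 0 * (lft phi * t)) ∧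
    ∀ t, (F 0 * (rgt phi * (rgt (ySum * xSum) * t)) : PathAlg m d S ⊗[ℂ] PathAlg m d S) =
      F 0 * t + F 0 * (rgt (xSum * ySum) * t) - F 0 * (rgt phi * t) := by
  have h : (phi * (ySum * xSum) : PathAlg m d S) = idem + xSum * ySum - phi := by
    rw [← phi_mul_yx, mul_add, phi_mul_idem, add_sub_cancel_left]
  have h₁ : (F 0 * (lft phi * lft (ySum * xSum)) : PathAlg m d S ⊗[ℂ] PathAlg m d S) =
      F 0 + F 0 * lft (xSum * ySum) - F 0 * lft phi := by
    rw [← map_mul, h, map_sub, map_add, mul_sub, mul_add, F_mul_lft_idem]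
  have h₂ : (F 0 * (rgt phi * rgt (ySum * xSum)) : PathAlg m d S ⊗[ℂ] PathAlg m d S) =
      F 0 + F 0 * rgt (xSum * ySum) - F 0 * rgt phi := by
    rw [← map_mul, h, map_sub, map_add, mul_sub, mul_add, F_mul_rgt_idem]
  refine ⟨h₁, h₂, fun t => ?_, fun t => ?_⟩
  · have := congrArg (· * t) h₁
    simpa only [add_mul, sub_mul, mul_assoc] using this
  · have := congrArg (· * t) h₂
    simpa only [add_mul, sub_mul, mul_assoc] using this

/-- All letters are moved behind `F_0` except for `x ⊗ 1`, which stays in front; then the relation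
`φ (∑ e_s + yx) = ∑ e_s + xy` finishes the comparison. -/
lemma isMomentAt_phi_xSum : IsMomentAt doubleBracket phi (xSum : PathAlg m d S) := by
  refine isMomentAt_phi_of_brackets ?_
  rw [doubleBracket_xy_xSum, doubleBracket_yx_xSum, map_add lft]
  simp only [mul_add, add_mul, mul_sub, sub_mul, mul_smul_comm, smul_mul_assoc, mul_assoc,
    rgt_mul_lft, rgt_mul_lft_assoc, isHomog_phi.comm_F, F_mul_idem, mul_idem_rules phi_mul_idem,
    F_mul_phi_yx, add_zero, neg_zero, mul_two]
  module

lemma isMomentAt_phi_ySum : IsMomentAt doubleBracket phi (ySum : PathAlg m d S) := by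
  refine isMomentAt_phi_of_brackets ?_
  rw [doubleBracket_xy_ySum, doubleBracket_yx_ySum, map_add lft]
  simp only [mul_add, add_mul, mul_sub, sub_mul, mul_smul_comm, smul_mul_assoc, mul_assoc,
    rgt_mul_lft, rgt_mul_lft_assoc, isHomog_phi.comm_F, F_mul_idem, mul_idem_rules phi_mul_idem,
    F_mul_phi_yx, add_zero, neg_zero, mul_two]
  module

lemma isMomentAt_phi_idem : IsMomentAt doubleBracket phi (idem : PathAlg m d S) := by
  have hB := isDoubleBracket_doubleBracket (S := S)
  rw [IsMomentAt, hB.skew, doubleBracket_idem_left, map_zero, neg_zero, mul_assoc, F_mul_rgt_idem,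
    add_mul, isHomog_phi.lft_mul_F, isHomog_phi.rgt_mul_F, mul_add]
  simp only [isHomog_idem.comm_F, add_zero, sub_zero, F_mul_idem, ← mul_assoc]
  simp

lemma isMomentAt_phi_phi : IsMomentAt doubleBracket phi (phi : PathAlg m d S) := by
  have hB := isDoubleBracket_doubleBracket (S := S)
  have hi := isMomentAt_phi_idem (S := S)
  have hx := isMomentAt_phi_xSum (S := S)
  have hy := isMomentAt_phi_ySum (S := S)
  have hr := hi.add hB (hy.mul hB hx)
  have h := (hi.add hB (hx.mul hB hy)).mul hB
    (hr.local_inverse hB hi yxInv_mul mul_yxInv yxInv_mul_idem)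
  rwa [← phi_eq] at h

/-! ### The elements `∑ e_s + xy` and `x⁻¹ + y` -/

lemma doubleBracket_xy_xy :
    doubleBracket (idem + xSum * ySum : PathAlg m d S) (idem + xSum * ySum) =
      (1 / 2 : ℂ) • (lft (idem + xSum * ySum) * F 0 * lft (idem + xSum * ySum) -
        rgt (idem + xSum * ySum) * F 0 * rgt (idem + xSum * ySum)) := by
  have hB := isDoubleBracket_doubleBracket (S := S)
  rw [hB.add_right, hB.mul_right, doubleBracket_xy_xSum, doubleBracket_xy_ySum,
    hB.skew _ idem, doubleBracket_idem_left, map_zero, neg_zero, zero_add]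
  simp only [map_add, map_mul, mul_add, add_mul, mul_sub, sub_mul, mul_smul_comm, smul_mul_assoc,
    mul_assoc, isHomog_xSum.comm_F, isHomog_ySum.comm_F, isHomog_idem.comm_F, F_mul_idem,
    mul_idem_rules ySum_mul_idem, add_zero, zero_add, neg_neg, neg_zero, neg_add_cancel,
    add_neg_cancel, mul_two]
  module

section Inverse

variable {t : PathAlg m d S}

/-- The value on a local inverse `t` of `x`, from `{{t x, c}} = 0`. -/
lemma doubleBracket_xInv_left (hxt : xSum * t = idem) (htx : t * xSum = idem)
    (hti : t * idem = t) (c : PathAlg m d S) :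
    doubleBracket t c = -(rgt t * doubleBracket xSum c * lft t) := by
  have hB := isDoubleBracket_doubleBracket (S := S)
  have h₁ := hB.mul_left t idem c
  have h₂ := hB.mul_left t xSum c
  rw [hti, doubleBracket_idem_left, mul_zero, zero_add, ← hxt, map_mul, ← mul_assoc] at h₁
  rw [htx, doubleBracket_idem_left] at h₂
  rw [h₁, eq_neg_of_add_eq_zero_right h₂.symm, neg_mul]

/-- The bracket `{{z, z}}` for `z = y + t`, where `t` is the local inverse of `x`. -/
lemma doubleBracket_z_z (ht : IsHomog 1 t) (hxt : xSum * t = idem) (htx : t * xSum = idem)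
    (hti : t * idem = t) : doubleBracket (ySum + t) (ySum + t) =
      -((1 / 2 : ℂ) • (lft (ySum + t) * F 0 * lft (ySum + t) -
        rgt (ySum + t) * F 0 * rgt (ySum + t))) := by
  have hB := isDoubleBracket_doubleBracket (S := S)
  have hl : (∀ f : PathAlg m d S ⊗[ℂ] PathAlg m d S, lft xSum * (lft t * f) = lft idem * f) ∧
      ∀ f : PathAlg m d S ⊗[ℂ] PathAlg m d S, lft t * (lft xSum * f) = lft idem * f := by
    simp only [← mul_assoc, ← map_mul, hxt, htx, implies_true, and_self]
  have hr : (∀ f : PathAlg m d S ⊗[ℂ] PathAlg m d S, rgt xSum * (rgt t * f) = rgt idem * f) ∧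
      ∀ f : PathAlg m d S ⊗[ℂ] PathAlg m d S, rgt t * (rgt xSum * f) = rgt idem * f := by
    simp only [← mul_assoc, ← map_mul, hxt, htx, implies_true, and_self]
  have hl' : lft xSum * lft t = (lft idem : PathAlg m d S ⊗[ℂ] PathAlg m d S) ∧
      lft t * lft xSum = (lft idem : PathAlg m d S ⊗[ℂ] PathAlg m d S) ∧
      lft t * lft idem = (lft t : PathAlg m d S ⊗[ℂ] PathAlg m d S) := by
    simp only [← map_mul, hxt, htx, hti, and_self]
  have hr' : rgt xSum * rgt t = (rgt idem : PathAlg m d S ⊗[ℂ] PathAlg m d S) ∧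
      rgt t * rgt xSum = (rgt idem : PathAlg m d S ⊗[ℂ] PathAlg m d S) ∧
      rgt t * rgt idem = (rgt t : PathAlg m d S ⊗[ℂ] PathAlg m d S) := by
    simp only [← map_mul, hxt, htx, hti, and_self]
  rw [hB.add_left, hB.add_right, hB.add_right, hB.skew ySum t,
    doubleBracket_xInv_left hxt htx hti, doubleBracket_xInv_left hxt htx hti, hB.skew xSum t,
    doubleBracket_xInv_left hxt htx hti, doubleBracket_xSum_xSum, doubleBracket_xSum_ySum,
    doubleBracket_ySum_ySum]
  simp only [map_neg, map_smul, map_sub, map_add, map_mul, flip_lft, flip_rgt, flip_F, mul_add,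
    add_mul, mul_sub, sub_mul, mul_smul_comm, smul_mul_assoc, mul_assoc, rgt_mul_lft,
    rgt_mul_lft_assoc, isHomog_xSum.comm_F, ht.comm_F, hl, hr, hr', isHomog_ySum.comm_F, F_mul_idem,
    mul_idem_rules ySum_mul_idem, zero_add, neg_neg, neg_zero, neg_add, add_neg_cancel,
    add_neg_cancel_right]
  module

end Inverse

/-! ### Brackets of powers modulo commutators -/

/-- The projection `A → A / [A, A]`. -/
def cyc : PathAlg m d S →ₗ[ℂ] PathAlg m d S ⧸ commutators m d S := (commutators m d S).mkQ

lemma cyc_mul_comm (a b : PathAlg m d S) : cyc (a * b) = cyc (b * a) :=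
  (Submodule.Quotient.eq _).2 (Submodule.subset_span ⟨a, b, rfl⟩)

/-- The linear map `p ⊗ q ↦ p b q c` from `A ⊗ A` to `A / [A, A]`. -/
def cycMul (b c : PathAlg m d S) :
    PathAlg m d S ⊗[ℂ] PathAlg m d S →ₗ[ℂ] PathAlg m d S ⧸ commutators m d S :=
  cyc ∘ₗ LinearMap.mul' ℂ (PathAlg m d S) ∘ₗ
    TensorProduct.map (LinearMap.mulRight ℂ b) (LinearMap.mulRight ℂ c)

lemma cycMul_tmul (b c p q : PathAlg m d S) : cycMul b c (p ⊗ₜ q) = cyc (p * b * (q * c)) := rfl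

variable (a b c : PathAlg m d S) (t : PathAlg m d S ⊗[ℂ] PathAlg m d S)

lemma cycMul_lft_mul : cycMul b c (lft a * t) = cycMul b (c * a) t := by
  induction t with
  | zero => simp
  | add t t' h h' => simp only [mul_add, map_add, h, h']
  | tmul p q =>
    rw [lft_apply, Algebra.TensorProduct.tmul_mul_tmul, one_mul, cycMul_tmul, cycMul_tmul,
      mul_assoc, mul_assoc, cyc_mul_comm]
    simp only [mul_assoc]

lemma cycMul_mul_lft : cycMul b c (t * lft a) = cycMul (a * b) c t := by
  induction t with
  | zero => simp
  | add t t' h h' => simp only [add_mul, map_add, h, h']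
  | tmul p q =>
    rw [lft_apply, Algebra.TensorProduct.tmul_mul_tmul, mul_one, cycMul_tmul, cycMul_tmul]
    simp only [mul_assoc]

lemma cycMul_rgt_mul : cycMul b c (rgt a * t) = cycMul (b * a) c t := by
  induction t with
  | zero => simp
  | add t t' h h' => simp only [mul_add, map_add, h, h']
  | tmul p q =>
    rw [rgt_apply, Algebra.TensorProduct.tmul_mul_tmul, one_mul, cycMul_tmul, cycMul_tmul]
    simp only [mul_assoc]

lemma cycMul_mul_rgt : cycMul b c (t * rgt a) = cycMul b (a * c) t := by
  induction t with
  | zero => simp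
  | add t t' h h' => simp only [add_mul, map_add, h, h']
  | tmul p q =>
    rw [rgt_apply, Algebra.TensorProduct.tmul_mul_tmul, mul_one, cycMul_tmul, cycMul_tmul]
    simp only [mul_assoc]

lemma cycMul_one_one : cycMul 1 1 t = cyc (LinearMap.mul' ℂ _ t) := by
  simp [cycMul, LinearMap.mulRight_one]

variable {B : PathAlg m d S → PathAlg m d S → PathAlg m d S ⊗[ℂ] PathAlg m d S}

lemma cycMul_pow_right (hB : IsDoubleBracket B) (V : PathAlg m d S) (n j : ℕ) :
    cycMul b (V ^ j) (B a (V ^ (n + 1))) = (n + 1 : ℂ) • cycMul b (V ^ (n + j)) (B a V) := by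
  induction n generalizing j with
  | zero => simp
  | succ n ih =>
    rw [pow_succ' V (n + 1), hB.mul_right, map_add, cycMul_lft_mul, ← pow_succ, ih, cycMul_mul_rgt,
      ← pow_add, Nat.cast_succ, show n + 1 + j = n + (j + 1) by ring]
    module

lemma cycMul_pow_left (hB : IsDoubleBracket B) (U : PathAlg m d S) (n j : ℕ) :
    cycMul (U ^ j) c (B (U ^ (n + 1)) b) = (n + 1 : ℂ) • cycMul (U ^ (n + j)) c (B U b) := by
  induction n generalizing j with
  | zero => simp
  | succ n ih =>
    rw [pow_succ' U (n + 1), hB.mul_left, map_add, cycMul_rgt_mul, ← pow_succ, ih, cycMul_mul_lft,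
      ← pow_add, Nat.cast_succ, show n + 1 + j = n + (j + 1) by ring]
    module

/-- Modulo commutators, `{U^K, V^L} = K L {{U, V}}' U^{K-1} {{U, V}}'' V^{L-1}`. -/
lemma cyc_bracket_pow (hB : IsDoubleBracket B) (U V : PathAlg m d S) (n l : ℕ) :
    cyc (LinearMap.mul' ℂ _ (B (U ^ (n + 1)) (V ^ (l + 1)))) =
      ((n + 1 : ℂ) * (l + 1)) • cycMul (U ^ n) (V ^ l) (B U V) := by
  have h₁ := cycMul_pow_right (U ^ (n + 1)) 1 hB V l 0
  have h₂ := cycMul_pow_left V (V ^ l) hB U n 0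
  rw [pow_zero, add_zero] at h₁ h₂
  rw [← cycMul_one_one, h₁, h₂, smul_smul, mul_comm]

section Involution

variable {k : ZMod m} {u g : PathAlg m d S}

/-- The double bracket of `U = u (1 + η g)` and `V = u (1 + η' g)`, written with `W = u g`. The
terms in which `g` occurs apart from `u` in `{{u, u g}} = {{u, u}} g + u {{u, g}}` cancel; this is
where the relative sign of `{{u, u}}` and the moment map property matters. -/
lemma bracket_U_V (hB : IsDoubleBracket B) (hu : IsHomog k u) (hg : IsHomog 0 g)
    (huu : B u u = -((1 / 2 : ℂ) • (lft u * F 0 * lft u - rgt u * F 0 * rgt u)))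
    (hgu : IsMomentAt B g u) (hgg : IsMomentAt B g g) (η η' : ℂ) :
    B (u * (1 + η • g)) (u * (1 + η' • g)) = (1 / 2 : ℂ) •
      (rgt (u - η • (u * g)) * F 0 * rgt (u * (1 + η' • g)) -
        lft (u - η' • (u * g)) * F 0 * lft (u * (1 + η • g)) +
        (η - η') • (lft u * (rgt (u * g) * F 0) + lft (u * g) * (rgt u * F 0))) := by
  have hug : B u g = -(1 / 2 : ℂ) • (rgt u * ((rgt g + lft g) * F 0) -
      (rgt g + lft g) * F 0 * lft u) := by
    rw [hB.skew, hgu]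
    simp only [map_smul, map_sub, map_add, map_mul, flip_lft, flip_rgt, flip_F, neg_zero]
    module
  rw [IsMomentAt] at hgu hgg
  simp only [mul_add, mul_one, mul_smul_comm, hB.add_left, hB.add_right, hB.smul_left,
    hB.smul_right, hB.mul_left, hB.mul_right, huu, hug, hgu, hgg]
  simp only [map_smul, map_sub, map_add, map_mul, mul_add, add_mul, mul_sub, sub_mul, mul_smul_comm,
    smul_mul_assoc, neg_mul, mul_assoc, rgt_mul_lft, rgt_mul_lft_assoc, hu.comm_F,
    hg.comm_F, add_zero, zero_add, neg_zero, neg_add_cancel, add_neg_cancel]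
  module

/-- The map `f ↦ ∑ e_s f e_s` fixes the elements of degree zero and kills those of any other degree.
So for given `K` all terms that the idempotents in `{{U, V}}` leave in `{U^K, V^L}` survive, or all
of them vanish. -/
lemma sum_e_mul_mul_e {j : ZMod m} {f : PathAlg m d S} (hf : IsHomog j f) (hi : idem * f = f) :
    ∑ s : ZMod m, e (some s) * f * e (some s) = (if j = 0 then 1 else 0 : ℂ) • f := by
  simp only [mul_assoc, hf _]
  simp only [← mul_assoc, e_mul_e]
  split_ifs with h
  · subst h
    simp only [add_zero, if_true, ← Finset.sum_mul, one_smul]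
    exact hi
  · simp [h]

lemma cycMul_F {j : ZMod m} (hb : IsHomog j b) (hi : idem * b = b) :
    cycMul b c (F 0) = (if j = 0 then 1 else 0 : ℂ) • cyc (b * c) := by
  rw [← map_smul, ← smul_mul_assoc, ← sum_e_mul_mul_e hb hi, Finset.sum_mul, F, map_sum, map_sum]
  simp only [cycMul_tmul, add_zero, mul_assoc]

/-- The cyclic identity behind the involutivity. For `η ≠ η'` both `u` and `W` are linear
combinations of `U = u + η W` and `V = u + η' W`, and everything becomes a combination of the
classes of `U^{n+2} V^l`, `U^{n+1} V^{l+1}` and `U^n V^{l+2}`. -/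
lemma cyc_identity (u W : PathAlg m d S) (η η' : ℂ) (n l : ℕ) :
    cyc ((u + η • W) ^ n * (u - η • W) * ((u + η' • W) * (u + η' • W) ^ l)) -
      cyc ((u + η • W) * (u + η • W) ^ n * ((u + η' • W) ^ l * (u - η' • W))) +
      (η - η') • (cyc ((u + η • W) ^ n * W * ((u + η' • W) ^ l * u)) +
        cyc ((u + η • W) ^ n * u * ((u + η' • W) ^ l * W))) = 0 := by
  obtain rfl | h := eq_or_ne η η'
  · rw [sub_self, zero_smul, add_zero, sub_eq_zero, ← pow_succ', ← pow_succ', cyc_mul_comm,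
      ← mul_assoc, ← mul_assoc, cyc_mul_comm (_ * _) (u - η • W), ← pow_add,
      ← pow_add, show l + 1 + n = n + 1 + l by ring, cyc_mul_comm]
  · have hd : η - η' ≠ 0 := sub_ne_zero.2 h
    set U := u + η • W with hU
    set V := u + η' • W with hV
    have hW : W = (η - η')⁻¹ • (U - V) := by
      rw [hU, hV, add_sub_add_left_eq_sub, ← sub_smul, smul_smul, inv_mul_cancel₀ hd, one_smul]
    have hu : u = (η - η')⁻¹ • (η • V - η' • U) := by
      rw [hU, hV, eq_comm, inv_smul_eq_iff₀ hd]; module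
    clear_value U V
    subst hW
    have hcU : U * U ^ n = U ^ n * U := by rw [← pow_succ, ← pow_succ']
    have hcV : V ^ l * V = V * V ^ l := by rw [← pow_succ, ← pow_succ']
    have h₁ : cyc (U ^ n * U * (V ^ l * U)) = cyc (U ^ n * U * (U * V ^ l)) := by
      rw [← mul_assoc, cyc_mul_comm, ← hcU]
      simp only [← mul_assoc, hcU]
    have h₂ : cyc (U ^ n * V * (V ^ l * U)) = cyc (U ^ n * U * (V * V ^ l)) := by
      rw [← mul_assoc, cyc_mul_comm, ← mul_assoc, ← mul_assoc, hcU]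
      simp only [mul_assoc]
    -- What remains is linear in the classes of three words, and holds coefficientwise.
    rw [hu]
    simp only [smul_mul_assoc, mul_smul_comm, mul_sub, sub_mul, map_sub, map_smul]
    simp only [hcU, hcV, h₁, h₂]
    match_scalars <;> field_simp <;> ring

/-- Let `{{-, -}}` be a double bracket, `g` an element with the moment map property at `g` and at
`u`, and `{{u, u}} = -½ ∑ (u e_s u ⊗ e_s - e_s ⊗ u e_s u)`. Then the powers of the elements
`u (1 + η g)` are in involution modulo commutators. -/
theorem mul'_bracket_pow_mem_commutators (hB : IsDoubleBracket B) (hu : IsHomog k u)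
    (hg : IsHomog 0 g) (hiu : idem * u = u)
    (huu : B u u = -((1 / 2 : ℂ) • (lft u * F 0 * lft u - rgt u * F 0 * rgt u)))
    (hgu : IsMomentAt B g u) (hgg : IsMomentAt B g g) (η η' : ℂ) {K L : ℕ} (hK : 1 ≤ K)
    (hL : 1 ≤ L) :
    LinearMap.mul' ℂ _ (B ((u * (1 + η • g)) ^ K) ((u * (1 + η' • g)) ^ L)) ∈
      commutators m d S := by
  obtain ⟨n, rfl⟩ := Nat.exists_eq_add_of_le' hK
  obtain ⟨l, rfl⟩ := Nat.exists_eq_add_of_le' hL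
  rw [← Submodule.Quotient.mk_eq_zero]
  change cyc _ = 0
  rw [cyc_bracket_pow hB, bracket_U_V hB hu hg huu hgu hgg]
  have hW : IsHomog k (u * g) := by simpa using hu.mul hg
  have hiW : idem * (u * g) = u * g := by rw [← mul_assoc, hiu]
  have hexp (η : ℂ) : u * (1 + η • g) = u + η • (u * g) := by
    rw [mul_add, mul_one, mul_smul_comm]
  simp only [hexp]
  generalize u * g = W at *
  have hU : IsHomog k (u + η • W) := hu.add (hW.smul η)
  have hi {a : PathAlg m d S} (ha : idem * a = a) :
      idem * ((u + η • W) ^ n * a) = (u + η • W) ^ n * a := by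
    cases n with
    | zero => simpa using ha
    | succ n => rw [pow_succ', ← mul_assoc, ← mul_assoc, mul_add, mul_smul_comm, hiu, hiW]
  -- All the elements `U^n a` with `a` homogeneous of the degree of `u` have the same degree.
  have hF {a : PathAlg m d S} (ha : IsHomog k a) (hia : idem * a = a) (c : PathAlg m d S) :
      cycMul ((u + η • W) ^ n * a) c (F 0) =
        (if k + n * k = 0 then 1 else 0 : ℂ) • cyc ((u + η • W) ^ n * a * c) :=
    cycMul_F _ _ ((hU.pow n).mul ha) (hi hia)
  have hiU : idem * (u + η • W) = u + η • W := by rw [mul_add, mul_smul_comm, hiu, hiW]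
  have hsub : IsHomog k (u - η • W) := by
    simpa [sub_eq_add_neg] using hu.add (hW.smul (-η))
  have hisub : idem * (u - η • W) = u - η • W := by rw [mul_sub, mul_smul_comm, hiu, hiW]
  simp only [LinearMap.map_smul, LinearMap.map_add, LinearMap.map_sub, cycMul_lft_mul,
    cycMul_rgt_mul, cycMul_mul_lft, cycMul_mul_rgt]
  have hcomm : (u + η • W) * (u + η • W) ^ n = (u + η • W) ^ n * (u + η • W) := by
    rw [← pow_succ, ← pow_succ']
  rw [hcomm, hF hsub hisub, hF hU hiU, hF hu hiu, hF hW hiW, ← hcomm]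
  have h := cyc_identity u W η η' n l
  linear_combination (norm := module) (((n + 1) * (l + 1) * (1 / 2) *
    (if k + n * k = 0 then 1 else 0) : ℂ)) • h

end Involution

/-! ### The four choices of `u` -/

/-- For `ε(u) = -1` the double bracket itself and `φ` satisfy the hypotheses of the involutivity
criterion. -/
lemma bracket_phi_pow_mem_commutators {k : ZMod m} {u : PathAlg m d S} (hu : IsHomog k u)
    (hiu : idem * u = u)
    (huu : doubleBracket u u = -((1 / 2 : ℂ) • (lft u * F 0 * lft u - rgt u * F 0 * rgt u)))
    (hφ : IsMomentAt doubleBracket phi u) (η η' : ℂ) {K L : ℕ} (hK : 1 ≤ K) (hL : 1 ≤ L) :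
    bracket ((u * (1 + η • phi)) ^ K) ((u * (1 + η' • phi)) ^ L) ∈ commutators m d S :=
  mul'_bracket_pow_mem_commutators isDoubleBracket_doubleBracket hu isHomog_phi hiu huu hφ
    isMomentAt_phi_phi η η' hK hL

lemma isMomentAt_phiInv {a : PathAlg m d S} (ha : IsMomentAt doubleBracket phi a) :
    IsMomentAt (fun b c => -doubleBracket b c) phiInv a :=
  ha.neg_inverse isDoubleBracket_doubleBracket (doubleBracket_idem_left a) isHomog_phi
    isHomog_phiInv phi_phiInv.1 phi_phiInv.2 idem_mul_phiInv

/-- For `ε(u) = 1` the opposite of the double bracket and `φ⁻¹` satisfy the hypotheses of the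
involutivity criterion. -/
lemma bracket_phiInv_pow_mem_commutators {k : ZMod m} {u : PathAlg m d S} (hu : IsHomog k u)
    (hiu : idem * u = u)
    (huu : doubleBracket u u = (1 / 2 : ℂ) • (lft u * F 0 * lft u - rgt u * F 0 * rgt u))
    (hφ : IsMomentAt doubleBracket phi u) (η η' : ℂ) {K L : ℕ} (hK : 1 ≤ K) (hL : 1 ≤ L) :
    bracket ((u * (1 + η • phiInv)) ^ K) ((u * (1 + η' • phiInv)) ^ L) ∈ commutators m d S := by
  have hB := isDoubleBracket_doubleBracket (S := S)
  have h : IsMomentAt doubleBracket phi (phiInv : PathAlg m d S) :=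
    isMomentAt_phi_phi.local_inverse hB isMomentAt_phi_idem phi_phiInv.2 phi_phiInv.1
      phiInv_mul_idem
  have := mul'_bracket_pow_mem_commutators hB.neg hu isHomog_phiInv hiu (by rw [huu])
    (isMomentAt_phiInv hφ) (isMomentAt_phiInv h) η η' hK hL
  rw [map_neg, neg_mem_iff] at this
  exact this

section Inverse

variable {S : Set (Arrow m d)} (hS : ∀ s, Arrow.x s ∈ S)

/-- The element `x⁻¹ = ∑ x_s⁻¹`. -/
def xInv (hS : ∀ s, Arrow.x s ∈ S) : PathAlg m d S := ∑ s : ZMod m, linv ⟨.x s, hS s⟩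

lemma e_mul_linv (s : ZMod m) :
    (e (some (s + 1)) * linv ⟨.x s, hS s⟩ : PathAlg m d S) = linv ⟨.x s, hS s⟩ :=
  e_head_linv (⟨.x s, hS s⟩ : S)

lemma linv_mul_e (s : ZMod m) :
    (linv ⟨.x s, hS s⟩ * e (some s) : PathAlg m d S) = linv ⟨.x s, hS s⟩ :=
  linv_e_tail (⟨.x s, hS s⟩ : S)

lemma e_mul_xInv (s : ZMod m) :
    (e (some (s + 1)) * xInv hS : PathAlg m d S) = linv ⟨.x s, hS s⟩ :=
  e_mul_sum _ 1 (e_mul_linv hS) s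

lemma xInv_mul_e (s : ZMod m) :
    (xInv hS * e (some s) : PathAlg m d S) = linv ⟨.x s, hS s⟩ := by
  simpa [xInv] using sum_mul_e (fun s => linv ⟨.x s, hS s⟩) 0 (by simpa using linv_mul_e hS) s

lemma isHomog_xInv : IsHomog 1 (xInv hS : PathAlg m d S) := fun s => by
  rw [e_mul_xInv, xInv_mul_e]

lemma xInv_mul_idem : (xInv hS * idem : PathAlg m d S) = xInv hS := by
  simp only [idem, Finset.mul_sum, xInv_mul_e]
  rfl

lemma idem_mul_xInv : (idem * xInv hS : PathAlg m d S) = xInv hS := by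
  conv_lhs => rw [idem, ← sum_shift, Finset.sum_mul]
  simp only [e_mul_xInv]
  rfl

lemma xSum_mul_xInv : (xSum * xInv hS : PathAlg m d S) = idem := by
  rw [xSum, Finset.sum_mul, idem]
  refine Finset.sum_congr rfl fun s _ => ?_
  rw [← x_mul_e, mul_assoc, e_mul_xInv]
  exact mul_linv (⟨.x s, hS s⟩ : S)

lemma xInv_mul_xSum : (xInv hS * xSum : PathAlg m d S) = idem := by
  conv_rhs => rw [idem, ← sum_shift]
  rw [xInv, Finset.sum_mul]
  refine Finset.sum_congr rfl fun s _ => ?_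
  rw [← linv_mul_e, mul_assoc, e_mul_xSum]
  exact linv_mul (⟨.x s, hS s⟩ : S)

end Inverse

end SpinCyclic

end

open SpinCyclic in
theorem proposition3p4 (m d : ℕ) [NeZero m] (hm : 2 ≤ m) (hd : 2 ≤ d)
    (u : SpinCyclic.Letter) (η η' : ℂ) (K L : ℕ) (hK : 1 ≤ K) (hL : 1 ≤ L) :
    (u.sign = -1 →
      SpinCyclic.bracket (u.UPlus m d η ^ K) (u.UPlus m d η' ^ L) ∈
        SpinCyclic.commutators m d (u.inverted m d)) ∧
    (u.sign = 1 →
      SpinCyclic.bracket (u.UMinus m d η ^ K) (u.UMinus m d η' ^ L) ∈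
        SpinCyclic.commutators m d (u.inverted m d)) := by
  cases u with
  | x =>
    refine ⟨fun h => absurd h (by decide), fun _ => ?_⟩
    exact bracket_phiInv_pow_mem_commutators isHomog_xSum idem_mul_xSum doubleBracket_xSum_xSum
      isMomentAt_phi_xSum η η' hK hL
  | y =>
    refine ⟨fun _ => ?_, fun h => absurd h (by decide)⟩
    exact bracket_phi_pow_mem_commutators isHomog_ySum idem_mul_ySum doubleBracket_ySum_ySum
      isMomentAt_phi_ySum η η' hK hL
  | z =>
    refine ⟨fun _ => ?_, fun h => absurd h (by decide)⟩
    have hB := isDoubleBracket_doubleBracket (S := Letter.z.inverted m d)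
    have hS : ∀ s, Arrow.x s ∈ Letter.z.inverted m d := Set.mem_range_self
    have hz : Letter.z.elt m d = ySum + xInv hS := Finset.sum_add_distrib ..
    have hx := isMomentAt_phi_xSum.local_inverse hB isMomentAt_phi_idem (xInv_mul_xSum hS)
      (xSum_mul_xInv hS) (xInv_mul_idem hS)
    simp only [Letter.UPlus, hz]
    exact bracket_phi_pow_mem_commutators (isHomog_ySum.add (isHomog_xInv hS))
      (by rw [mul_add, idem_mul_ySum, idem_mul_xInv])
      (doubleBracket_z_z (isHomog_xInv hS) (xSum_mul_xInv hS) (xInv_mul_xSum hS)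
        (xInv_mul_idem hS))
      (isMomentAt_phi_ySum.add hB hx) η η' hK hL
  | exy =>
    refine ⟨fun h => absurd h (by decide), fun _ => ?_⟩
    have hB := isDoubleBracket_doubleBracket (S := Letter.exy.inverted m d)
    have hu : IsHomog 0 (idem + xSum * ySum : Letter.exy.Alg m d) :=
      isHomog_idem.add (by simpa using isHomog_xSum.mul isHomog_ySum)
    exact bracket_phiInv_pow_mem_commutators hu
      (by rw [mul_add, idem_mul_idem, ← mul_assoc, idem_mul_xSum]) doubleBracket_xy_xy
      (isMomentAt_phi_idem.add hB (isMomentAt_phi_xSum.mul hB isMomentAt_phi_ySum)) η η' hK hL
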